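/- Let $(W,S)$ be a finite Coxeter system with $S=\{s_1,\dots,s_r\}$, so that $r$ is its rank, and let $\ell$ be its length function. For $w\in W$ let $d(w)$ be the number of left descents of $w$, i.e. of indices $j$ with $\ell(s_jw)<\ell(w)$. For $I\subseteq\{1,\dots,r\}$ let $W_I$ be the subgroup generated by $\{s_i : i\in I\}$ and let $w_0(W_I)$ be its longest element. For an integer $0\le x\le r$ put $$\mathsf{maxw}_0(W,x)=\max\{\ell(w_0(W_I)) : I\subseteq\{1,\dots,r\},\ |I|=x\}.$$ An element $w\in W$ is called proper if $\ell(w)\le r+\mathsf{maxw}_0(W,d(w))$. **Theorem.** Let $X_n$ be one of the families $A_n$, $B_n$, $D_n$ (of rank $r=n$) or $I_2(n)$ (the dihedral group of order $2n$, of rank $r=2$). For each $n$ (with $n\ge 2$ for $I_2(n)$) let $W_n$ be a Coxeter group of type $X_n$; it is finite. Let $w$ be sampled uniformly at random from $W_n$. Then $$\Pr[w\text{ is proper}]\longrightarrow 0\qquad\text{as } n\to\infty.$$ -/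

import Mathlib

open Filter Topology

universe u

/-- The Coxeter matrix of type `D_n` on the nodes `0, 1, …, n - 1`. The nodes `0` and `1` are the two
short legs of the fork: they are not joined to each other, and both are joined to the node `2`. The
remaining edges are `2 — 3 — ⋯ — (n - 1)`. All edges have label `3`.

(Mathlib's `CoxeterMatrix.D` joins its last three nodes in a triangle, so for `n ≥ 3` its Coxeter
group is infinite and not of type `D_n`; hence this definition.) -/
def coxeterMatrixD (n : ℕ) : CoxeterMatrix (Fin n) where
  M := Matrix.of fun i j : Fin n ↦
    if i = j then 1
    else if ((i : ℕ) = 0 ∧ (j : ℕ) = 2) ∨ ((j : ℕ) = 0 ∧ (i : ℕ) = 2) ∨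
        (1 ≤ (i : ℕ) ∧ (i : ℕ) + 1 = j) ∨ (1 ≤ (j : ℕ) ∧ (j : ℕ) + 1 = i) then 3
    else 2
  isSymm := by
    ext i j
    simp only [Matrix.transpose_apply, Matrix.of_apply]
    split_ifs <;> first | rfl | (exfalso; omega)
  diagonal := by simp
  off_diagonal := by
    intro i j h
    simp only [Matrix.of_apply, if_neg h]
    split_ifs <;> omega

namespace CoxeterSystem

variable {B : Type*} {M : CoxeterMatrix B} {W : Type*} [Group W] (cs : CoxeterSystem M W)

/-- The parabolic subgroup `W_I` generated by the simple reflections `s_i` with `i ∈ I`. -/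
def parabolic (I : Set B) : Subgroup W :=
  Subgroup.closure (cs.simple '' I)

/-- `ℓ(w₀(W_I))`, the length of the longest element of the parabolic subgroup `W_I`, that is, the
largest length of an element of `W_I`. (The set of lengths is nonempty, and bounded if `W_I` is
finite.) -/
noncomputable def lengthLongest (I : Set B) : ℕ :=
  sSup (cs.length '' (cs.parabolic I : Set W))

/-- `maxw₀(W, x)`, the maximum of `ℓ(w₀(W_I))` over the sets `I` of exactly `x` nodes. -/
noncomputable def maxw0 [Fintype B] (x : ℕ) : ℕ :=
  ((Finset.univ : Finset B).powersetCard x).sup fun I ↦ cs.lengthLongest (I : Set B)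

/-- `d(w)`, the number of left descents of `w`. -/
noncomputable def numLeftDescents (w : W) : ℕ :=
  {i : B | cs.IsLeftDescent w i}.ncard

/-- `w` is proper if `ℓ(w) ≤ r + maxw₀(W, d(w))`, where `r` is the rank of the Coxeter system,
that is, the number of its simple reflections. -/
def IsProper [Fintype B] (w : W) : Prop :=
  cs.length w ≤ Fintype.card B + cs.maxw0 (cs.numLeftDescents w)

/-- The probability that a uniformly random element of the (finite) group `W` is proper. -/
noncomputable def properProbability [Fintype B] : ℝ :=
  (Nat.card {w : W // cs.IsProper w} : ℝ) / (Nat.card W : ℝ)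

end CoxeterSystem

/-! For types A, B and D the proof is a second moment argument on positive roots. Give a positive
root β the sign −1 if it is an inversion of w, and 1 otherwise. Then 2ℓ(w) and 2d(w) are the numbers
of positive and of simple roots minus the sums of their signs (`two_mul_length`,
`two_mul_numLeftDescents`). If β and γ are orthogonal, left multiplication by the reflection in β
flips the sign of β and keeps that of γ, so the product of the two signs averages to 0
(`sum_sign_mul_sign`). The second moment of a sum of signs is therefore at most the number of
non-orthogonal pairs: O(n³) among the positive roots, O(n) among the simple ones.

Let c = 1/2 in type A and c = 1 in types B and D; there are about cn² positive roots. By Chebyshev,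
outside an event of probability O(1/n), ℓ(w) is at least about (7/16)cn² and d(w) ≤ (9/16)n. On the
other hand, the inversions of an element of W_I are supported on I (`lengthLongest_le`), and at most
c(|I|² + n) positive roots are, so the maximum in the definition of proper is at most (81/256)cn² +
O(n). As 81/256 < 7/16, such a w is not proper once n is large.

The algebraic input is that ℓ counts inversions. It is derived for `RootModel`, an explicit rational
realization; the crux is `coweight_act_root_nonneg`.

Dihedral groups have bounded rank and are treated directly: apart from the longest element, a proper
element has length at most 3, which leaves boundedly many among at least n elements. -/

section Reflect

/-! ### Reflections in rational vector spaces. -/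

variable {ι : Type*} [Fintype ι]

/-- The coroot functional `x ↦ 2 (a, x) / (a, a)` of a vector `a`. -/
def corootPairing (a : ι → ℚ) : (ι → ℚ) →ₗ[ℚ] ℚ where
  toFun x := 2 * (a ⬝ᵥ x) / (a ⬝ᵥ a)
  map_add' x y := by rw [dotProduct_add]; ring
  map_smul' r x := by simp only [dotProduct_smul, smul_eq_mul, RingHom.id_apply]; ring

theorem corootPairing_apply (a x : ι → ℚ) : corootPairing a x = 2 * (a ⬝ᵥ x) / (a ⬝ᵥ a) := rfl

/-- The linear map `x ↦ x - 2 (a, x) / (a, a) • a`. -/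
def reflectionMap (a : ι → ℚ) : (ι → ℚ) →ₗ[ℚ] (ι → ℚ) :=
  LinearMap.id - (corootPairing a).smulRight a

theorem reflectionMap_apply (a x : ι → ℚ) : reflectionMap a x = x - corootPairing a x • a := rfl

theorem corootPairing_self {a : ι → ℚ} (ha : a ⬝ᵥ a ≠ 0) : corootPairing a a = 2 := by
  rw [corootPairing_apply]; field_simp

theorem reflectionMap_involutive (a : ι → ℚ) : Function.Involutive (reflectionMap a) := by
  intro x
  by_cases ha : a ⬝ᵥ a = 0
  · have h : ∀ y, corootPairing a y = 0 := fun y ↦ by simp [corootPairing_apply, ha]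
    simp [reflectionMap_apply, h]
  · simp only [reflectionMap_apply, map_sub, map_smul, corootPairing_self ha]
    module

theorem dotProduct_reflectionMap (a x y : ι → ℚ) :
    reflectionMap a x ⬝ᵥ reflectionMap a y = x ⬝ᵥ y := by
  by_cases ha : a ⬝ᵥ a = 0
  · simp [reflectionMap_apply, corootPairing_apply, ha]
  · simp only [reflectionMap_apply, corootPairing_apply, sub_dotProduct, dotProduct_sub,
      smul_dotProduct, dotProduct_smul, smul_eq_mul, dotProduct_comm x a]
    field_simp
    ring

/-- The reflection in `a` as a linear equivalence. -/
def reflectionEquiv (a : ι → ℚ) : (ι → ℚ) ≃ₗ[ℚ] (ι → ℚ) :=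
  LinearEquiv.ofInvolutive (reflectionMap a) (reflectionMap_involutive a)

theorem reflectionEquiv_apply (a x : ι → ℚ) :
    reflectionEquiv a x = x - corootPairing a x • a := rfl

theorem reflectionEquiv_mul_self (a : ι → ℚ) : reflectionEquiv a * reflectionEquiv a = 1 :=
  LinearEquiv.ext (reflectionMap_involutive a)

end Reflect

/-- A realization of a Coxeter matrix with entries at most `4` by reflections in a space `ι → ℚ`,
with a finite set of positive roots. -/
structure CoxeterMatrix.RootModel {B : Type*} (M : CoxeterMatrix B) (ι : Type*) [Fintype ι] where
  /-- The simple roots. -/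
  root : B → ι → ℚ
  /-- Vectors which are, up to positive factors, dual to the simple roots. -/
  coweight : B → ι → ℚ
  /-- The positive roots. -/
  pos : Finset (ι → ℚ)
  coweight_root_self : ∀ i, 0 < coweight i ⬝ᵥ root i
  coweight_root_of_ne : ∀ i j, i ≠ j → coweight i ⬝ᵥ root j = 0
  -- For the entry 4 only the product of p and q is fixed: the two roots have different lengths, and
  -- either may come first.
  cartan : ∀ i j, i ≠ j → ∃ p q : ℚ, 0 ≤ p ∧ 0 ≤ q ∧
    corootPairing (root i) (root j) = -p ∧ corootPairing (root j) (root i) = -q ∧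
    ((M i j = 2 ∧ p = 0 ∧ q = 0) ∨ (M i j = 3 ∧ p = 1 ∧ q = 1) ∨ (M i j = 4 ∧ p * q = 2))
  root_mem_pos : ∀ i, root i ∈ pos
  coweight_nonneg : ∀ β ∈ pos, ∀ k, 0 ≤ coweight k ⬝ᵥ β
  exists_coweight_pos : ∀ β ∈ pos, ∃ k, 0 < coweight k ⬝ᵥ β
  reflection_mem_pos : ∀ β ∈ pos, ∀ i, β ≠ root i → reflectionEquiv (root i) β ∈ pos
  /-- Every positive root is in the orbit of a simple root. -/
  pos_subset : ∀ S : Set (ι → ℚ), (∀ i, root i ∈ S) →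
    (∀ i, ∀ x ∈ S, reflectionEquiv (root i) x ∈ S) → ∀ β ∈ pos, β ∈ S

/-! ### The action of the Coxeter group on a root model. -/

namespace CoxeterMatrix.RootModel

variable {B : Type*} {M : CoxeterMatrix B} {ι : Type*} [Fintype ι] (R : M.RootModel ι)

theorem root_dotProduct_self_ne_zero (i : B) : R.root i ⬝ᵥ R.root i ≠ 0 := by
  intro h
  rw [dotProduct_self_eq_zero] at h
  have := R.coweight_root_self i
  simp [h] at this

theorem reflectionEquiv_root_self (i : B) :
    reflectionEquiv (R.root i) (R.root i) = -R.root i := by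
  rw [reflectionEquiv_apply, corootPairing_self (R.root_dotProduct_self_ne_zero i)]
  module

/-- Both reflections preserve the cosets x + span(α_i, α_j) and act on the two coefficients by
affine maps, so the relation (s_i s_j)^m = 1 is checked by computing coefficients. Linear
independence of the roots is not needed. -/
theorem isLiftable : M.IsLiftable fun i ↦ reflectionEquiv (R.root i) := by
  intro i j
  rcases eq_or_ne i j with rfl | hij
  · simp [reflectionEquiv_mul_self]
  obtain ⟨p, q, -, -, hp, hq, h⟩ := R.cartan i j hij
  have hi : ∀ x (a b : ℚ), reflectionEquiv (R.root i) (x + a • R.root i + b • R.root j) =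
      x + (-corootPairing (R.root i) x - a + p * b) • R.root i + b • R.root j := by
    intro x a b
    simp only [reflectionEquiv_apply, map_add, map_smul, hp,
      corootPairing_self (R.root_dotProduct_self_ne_zero i)]
    module
  have hj : ∀ x (a b : ℚ), reflectionEquiv (R.root j) (x + a • R.root i + b • R.root j) =
      x + a • R.root i + (-corootPairing (R.root j) x - b + q * a) • R.root j := by
    intro x a b
    simp only [reflectionEquiv_apply, map_add, map_smul, hq,
      corootPairing_self (R.root_dotProduct_self_ne_zero j)]
    module
  ext1 x
  have hx : x = x + (0 : ℚ) • R.root i + (0 : ℚ) • R.root j := by simp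
  rcases h with ⟨hM, rfl, rfl⟩ | ⟨hM, rfl, rfl⟩ | ⟨hM, hpq⟩
  · rw [hM]
    simp only [pow_succ, pow_zero, one_mul, LinearEquiv.mul_apply, LinearEquiv.coe_one, id_eq]
    nth_rw 1 [hx]
    simp only [hi, hj]
    module
  · rw [hM]
    simp only [pow_succ, pow_zero, one_mul, LinearEquiv.mul_apply, LinearEquiv.coe_one, id_eq]
    nth_rw 1 [hx]
    simp only [hi, hj]
    module
  · rw [hM]
    simp only [pow_succ, pow_zero, one_mul, LinearEquiv.mul_apply, LinearEquiv.coe_one, id_eq]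
    nth_rw 1 [hx]
    simp only [hi, hj]
    generalize corootPairing (R.root i) x = u
    generalize corootPairing (R.root j) x = v
    match_scalars
    · ring
    · linear_combination (-u * (p * q) * (p * q - 2) +
        p * v * (-(p * q) ^ 2 + 3 * (p * q) - 1)) * hpq
    · linear_combination (-v * (p * q) * (p * q - 2) - q * u * (p * q - 1)) * hpq

variable {W : Type*} [Group W] (cs : CoxeterSystem M W)

/-- The action of a Coxeter group on the space of a root model. -/
def act : W →* ((ι → ℚ) ≃ₗ[ℚ] (ι → ℚ)) := cs.lift ⟨_, R.isLiftable⟩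

theorem act_simple (i : B) : R.act cs (cs.simple i) = reflectionEquiv (R.root i) :=
  cs.lift_apply_simple R.isLiftable i

theorem act_simple_apply (i : B) (x : ι → ℚ) :
    R.act cs (cs.simple i) x = x - corootPairing (R.root i) x • R.root i := by
  rw [act_simple, reflectionEquiv_apply]

theorem act_mul_apply (v w : W) (x : ι → ℚ) : R.act cs (v * w) x = R.act cs v (R.act cs w x) := by
  rw [map_mul, LinearEquiv.mul_apply]

theorem act_inv_apply_act (w : W) (x : ι → ℚ) : R.act cs w⁻¹ (R.act cs w x) = x := by
  rw [← act_mul_apply, inv_mul_cancel, map_one, LinearEquiv.coe_one, id]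

theorem act_apply_act_inv (w : W) (x : ι → ℚ) : R.act cs w (R.act cs w⁻¹ x) = x := by
  rw [← act_mul_apply, mul_inv_cancel, map_one, LinearEquiv.coe_one, id]

theorem dotProduct_act (w : W) (x y : ι → ℚ) : R.act cs w x ⬝ᵥ R.act cs w y = x ⬝ᵥ y := by
  induction w using cs.simple_induction_left generalizing x y with
  | one => simp
  | mul_simple_left w i ih =>
    rw [act_mul_apply, act_mul_apply, act_simple]
    exact (dotProduct_reflectionMap _ _ _).trans (ih x y)

end CoxeterMatrix.RootModel

/-! ### Positive roots, descents, inversions and length. -/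

namespace CoxeterMatrix.RootModel

variable {B : Type*} {M : CoxeterMatrix B} {ι : Type*} [Fintype ι] (R : M.RootModel ι)
variable {W : Type*} [Group W] (cs : CoxeterSystem M W)

/-- If `i` is not a right descent of `w`, then `w` maps the simple root `i` to a vector with
nonnegative coordinates. -/
theorem coweight_act_root_nonneg {w : W} {i : B} (hi : ¬cs.IsRightDescent w i) (k : B) :
    0 ≤ R.coweight k ⬝ᵥ R.act cs w (R.root i) := by
  induction hN : cs.length w using Nat.strong_induction_on generalizing w i with
  | _ N ih =>
  subst hN
  rcases eq_or_ne w 1 with rfl | hw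
  · rcases eq_or_ne k i with rfl | hk
    · simpa using (R.coweight_root_self k).le
    · simp [R.coweight_root_of_ne k i hk]
  -- The argument takes place in the subgroup generated by s_i and s_j: the letters s_j, s_i, s_j, …
  -- are stripped from the right of w until neither i nor j is a descent. For the shorter element v
  -- so obtained, w α_i is a nonnegative combination of v α_i and v α_j, and the induction
  -- hypothesis applies to both.
  obtain ⟨j, hj⟩ := cs.exists_rightDescent_of_ne_one hw
  have hij : i ≠ j := by rintro rfl; exact hi hj
  obtain ⟨p, q, hp0, hq0, hp, hq, h⟩ := R.cartan i j hij
  have hii := corootPairing_self (R.root_dotProduct_self_ne_zero i)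
  have hjj := corootPairing_self (R.root_dotProduct_self_ne_zero j)
  have step : ∀ v l, R.act cs v (R.root l) = -R.act cs (v * cs.simple l) (R.root l) := by
    intro v l
    rw [act_mul_apply, act_simple, reflectionEquiv_root_self, map_neg, neg_neg]
  have stepi : ∀ v, R.act cs v (R.root i) = R.act cs (v * cs.simple j) (R.root i) +
      q • R.act cs (v * cs.simple j) (R.root j) := by
    intro v
    rw [← map_smul, ← map_add, act_mul_apply, map_add, map_smul, act_simple_apply,
      act_simple_apply, hq, hjj]
    congr 1
    module
  have stepj : ∀ v, R.act cs v (R.root j) = R.act cs (v * cs.simple i) (R.root j) +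
      p • R.act cs (v * cs.simple i) (R.root i) := by
    intro v
    rw [← map_smul, ← map_add, act_mul_apply, map_add, map_smul, act_simple_apply,
      act_simple_apply, hp, hii]
    congr 1
    module
  have lt_of : ∀ (v : W) l, cs.length (v * cs.simple l) < cs.length v →
      cs.length (v * cs.simple l) + 1 = cs.length v := fun v l h ↦ cs.isRightDescent_iff.1 h
  have back : ∀ (v : W) l, cs.length (v * cs.simple l) < cs.length v →
      ¬cs.IsRightDescent (v * cs.simple l) l := fun v l h ↦
    cs.isRightDescent_iff_not_isRightDescent_mul.1 h
  have hw_lt : cs.length w < cs.length (w * cs.simple i) := by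
    rw [cs.not_isRightDescent_iff.1 hi]; omega
  have hj1 := lt_of w j hj
  set v₁ := w * cs.simple j with hv₁
  have hjv₁ : ¬cs.IsRightDescent v₁ j := back w j hj
  have upper : ∀ v u : W, cs.length (v * u) ≤ cs.length v + cs.length u := cs.length_mul_le
  have hs : ∀ l, cs.length (cs.simple l) = 1 := cs.length_simple
  have main : ∀ v, cs.length v < cs.length w → ¬cs.IsRightDescent v i → ¬cs.IsRightDescent v j →
      ∀ a b : ℚ, 0 ≤ a → 0 ≤ b →
      0 ≤ R.coweight k ⬝ᵥ (a • R.act cs v (R.root i) + b • R.act cs v (R.root j)) := by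
    intro v hv h1 h2 a b ha hb
    rw [dotProduct_add, dotProduct_smul, dotProduct_smul]
    exact add_nonneg (mul_nonneg ha (ih _ hv h1 rfl)) (mul_nonneg hb (ih _ hv h2 rfl))
  by_cases hiv₁ : cs.IsRightDescent v₁ i
  swap
  · rw [stepi w]
    have := main v₁ (by omega) hiv₁ hjv₁ 1 q zero_le_one hq0
    rwa [one_smul] at this
  have hi1 := lt_of v₁ i hiv₁
  set v₂ := v₁ * cs.simple i with hv₂
  have hiv₂ : ¬cs.IsRightDescent v₂ i := back v₁ i hiv₁
  -- By this relation w s_i is also the stripped element times the complementary alternating word.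
  -- If m = M i j letters could be stripped, that word would have m − 1 letters, so ℓ(w s_i) < ℓ(w),
  -- which is excluded.
  have key : w * cs.simple i = w * (cs.simple j * cs.simple i) ^ M i j * cs.simple i := by
    rw [M.symmetric i j, cs.simple_mul_simple_pow, mul_one]
  rcases h with ⟨hM, rfl, rfl⟩ | ⟨hM, rfl, rfl⟩ | ⟨hM, hpq⟩
  · exfalso
    have e : w * cs.simple i = v₂ * cs.simple j := by
      rw [key, hv₂, hv₁, hM]
      simp [pow_succ, mul_assoc]
    have := upper v₂ (cs.simple j)
    rw [← e, hs] at this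
    omega
  · have e : w * cs.simple i = v₂ * cs.simple j * (cs.simple i * cs.simple j) := by
      rw [key, hv₂, hv₁, hM]
      simp [pow_succ, mul_assoc]
    have hjv₂ : ¬cs.IsRightDescent v₂ j := by
      intro hd
      have h3 := lt_of v₂ j hd
      have h4 := upper (v₂ * cs.simple j) (cs.simple i * cs.simple j)
      have h5 := upper (cs.simple i) (cs.simple j)
      rw [← e] at h4
      rw [hs, hs] at h5
      omega
    have e2 : R.act cs w (R.root i) = R.act cs v₂ (R.root j) := by
      rw [stepi w, ← hv₁, stepj v₁, ← hv₂, step v₁ i, ← hv₂]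
      module
    rw [e2]
    exact ih _ (by omega) hjv₂ rfl
  · by_cases hjv₂ : cs.IsRightDescent v₂ j
    swap
    · have e2 : R.act cs w (R.root i) = (1 : ℚ) • R.act cs v₂ (R.root i) +
          q • R.act cs v₂ (R.root j) := by
        rw [stepi w, ← hv₁, stepj v₁, ← hv₂, step v₁ i, ← hv₂, smul_add, smul_smul, mul_comm q,
          hpq]
        module
      rw [e2]
      exact main v₂ (by omega) hiv₂ hjv₂ 1 q zero_le_one hq0
    have hj2 := lt_of v₂ j hjv₂
    set v₃ := v₂ * cs.simple j with hv₃
    have e : w * cs.simple i =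
        v₃ * cs.simple i * (cs.simple j * cs.simple i * cs.simple j) := by
      rw [key, hv₃, hv₂, hv₁, hM]
      simp [pow_succ, mul_assoc]
    have hiv₃ : ¬cs.IsRightDescent v₃ i := by
      intro hd
      have h3 := lt_of v₃ i hd
      have h4 := upper (v₃ * cs.simple i) (cs.simple j * cs.simple i * cs.simple j)
      have h5 := upper (cs.simple j * cs.simple i) (cs.simple j)
      have h6 := upper (cs.simple j) (cs.simple i)
      rw [← e] at h4
      rw [hs] at h5 h6
      rw [hs] at h6
      omega
    have e2 : R.act cs w (R.root i) = R.act cs v₃ (R.root i) := by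
      rw [stepi w, ← hv₁, stepj v₁, ← hv₂, step v₁ i, ← hv₂, smul_add, smul_smul, mul_comm q,
        hpq, stepi v₂, ← hv₃, step v₂ j, ← hv₃]
      module
    rw [e2]
    exact ih _ (by omega) hiv₃ rfl

theorem neg_notMem_pos {β : ι → ℚ} (h : β ∈ R.pos) : -β ∉ R.pos := by
  intro h'
  obtain ⟨k, hk⟩ := R.exists_coweight_pos β h
  have := R.coweight_nonneg _ h' k
  rw [dotProduct_neg] at this
  linarith

theorem act_mem_pos_or (w : W) {β : ι → ℚ} (h : β ∈ R.pos) :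
    R.act cs w β ∈ R.pos ∨ -R.act cs w β ∈ R.pos := by
  induction w using cs.simple_induction_left with
  | one => simp [h]
  | mul_simple_left w i ih =>
    have key : ∀ γ ∈ R.pos, reflectionEquiv (R.root i) γ ∈ R.pos ∨
        -reflectionEquiv (R.root i) γ ∈ R.pos := by
      intro γ hγ
      by_cases e : γ = R.root i
      · right; rw [e, reflectionEquiv_root_self, neg_neg]; exact R.root_mem_pos i
      · exact Or.inl (R.reflection_mem_pos γ hγ i e)
    rw [act_mul_apply, act_simple]
    rcases ih with ih | ih
    · exact key _ ih
    · have := key _ ih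
      rw [map_neg, neg_neg] at this
      exact this.symm

theorem neg_act_mem_pos_iff (w : W) {β : ι → ℚ} (h : β ∈ R.pos) :
    -R.act cs w β ∈ R.pos ↔ R.act cs w β ∉ R.pos :=
  ⟨fun h' h'' ↦ R.neg_notMem_pos h'' h', (R.act_mem_pos_or cs w h).resolve_left⟩

/-- The image of a root is positive or negative, and a negative one has a negative coordinate,
against `coweight_act_root_nonneg`. For the converse, apply this to w s_i. -/
theorem act_root_mem_pos_iff (w : W) (i : B) :
    R.act cs w (R.root i) ∈ R.pos ↔ ¬cs.IsRightDescent w i := by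
  have key : ∀ v : W, ¬cs.IsRightDescent v i → R.act cs v (R.root i) ∈ R.pos := by
    intro v hv
    rcases R.act_mem_pos_or cs v (R.root_mem_pos i) with h | h
    · exact h
    · obtain ⟨k, hk⟩ := R.exists_coweight_pos _ h
      have := R.coweight_act_root_nonneg cs hv k
      rw [dotProduct_neg] at hk
      linarith
  refine ⟨fun h hd ↦ ?_, key w⟩
  have := key _ (cs.isRightDescent_iff_not_isRightDescent_mul.1 hd)
  rw [act_mul_apply, act_simple, reflectionEquiv_root_self, map_neg] at this
  exact R.neg_notMem_pos h this

theorem neg_act_inv_root_mem_pos_iff (w : W) (i : B) :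
    -R.act cs w⁻¹ (R.root i) ∈ R.pos ↔ cs.IsLeftDescent w i := by
  rw [R.neg_act_mem_pos_iff cs _ (R.root_mem_pos i), R.act_root_mem_pos_iff, not_not,
    cs.isRightDescent_inv_iff]

-- An element sending every simple root to a positive root has no descents and so is 1; hence w is
-- determined by its images of the simple roots, which lie in a finite set.
include R cs in
theorem finite [Finite B] : Finite W := by
  classical
  have : Finite (R.pos ∪ R.pos.image (-·) : Finset (ι → ℚ)) := inferInstance
  refine Finite.of_injective (β := B → (R.pos ∪ R.pos.image (-·) : Finset (ι → ℚ)))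
    (fun w i ↦ ⟨R.act cs w (R.root i), ?_⟩) ?_
  · rw [Finset.mem_union, Finset.mem_image]
    refine (R.act_mem_pos_or cs w (R.root_mem_pos i)).imp_right fun h ↦ ⟨_, h, neg_neg _⟩
  · intro v w h
    have h' : ∀ i, R.act cs v (R.root i) = R.act cs w (R.root i) := fun i ↦
      congrArg Subtype.val (congrFun h i)
    rw [← inv_mul_eq_one]
    by_contra hne
    obtain ⟨i, hi⟩ := cs.exists_rightDescent_of_ne_one hne
    refine (R.act_root_mem_pos_iff cs _ i).1 ?_ hi
    rw [act_mul_apply, ← h', act_inv_apply_act]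
    exact R.root_mem_pos i

open Classical in
/-- The positive roots made negative by `w⁻¹`. -/
noncomputable def inversions (w : W) : Finset (ι → ℚ) := {β ∈ R.pos | -R.act cs w⁻¹ β ∈ R.pos}

theorem mem_inversions {w : W} {β : ι → ℚ} :
    β ∈ R.inversions cs w ↔ β ∈ R.pos ∧ -R.act cs w⁻¹ β ∈ R.pos := by
  simp [inversions]

theorem reflection_mem_inversions {w : W} {i : B} {β : ι → ℚ} (hβ : β ≠ R.root i)
    (h : β ∈ R.inversions cs w) :
    reflectionEquiv (R.root i) β ∈ R.inversions cs (cs.simple i * w) := by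
  rw [mem_inversions] at h ⊢
  refine ⟨R.reflection_mem_pos β h.1 i hβ, ?_⟩
  rw [mul_inv_rev, act_mul_apply, ← R.act_simple cs, act_inv_apply_act]
  exact h.2

/-- The reflection s_i permutes the positive roots other than α_i, and α_i is an inversion of w but
not of s_i w. -/
theorem card_inversions_simple_mul {w : W} {i : B} (h : cs.IsLeftDescent w i) :
    (R.inversions cs w).card = (R.inversions cs (cs.simple i * w)).card + 1 := by
  classical
  have hi : R.root i ∈ R.inversions cs w :=
    (R.mem_inversions cs).2 ⟨R.root_mem_pos i, (R.neg_act_inv_root_mem_pos_iff cs w i).2 h⟩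
  have hi' : R.root i ∉ R.inversions cs (cs.simple i * w) := by
    rw [mem_inversions, neg_act_inv_root_mem_pos_iff]
    exact fun h' ↦ cs.isLeftDescent_iff_not_isLeftDescent_mul.1 h h'.2
  have invol : ∀ x, reflectionEquiv (R.root i) (reflectionEquiv (R.root i) x) = x :=
    reflectionMap_involutive _
  rw [← Finset.card_erase_add_one hi]
  congr 1
  have hne : ∀ β ∈ R.pos, reflectionEquiv (R.root i) β ≠ R.root i := by
    intro β hβ e
    have := invol β
    rw [e, reflectionEquiv_root_self] at this
    exact R.neg_notMem_pos (R.root_mem_pos i) (this ▸ hβ)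
  refine Finset.card_bij' (fun β _ ↦ reflectionEquiv (R.root i) β)
    (fun β _ ↦ reflectionEquiv (R.root i) β) ?_ ?_ ?_ ?_
  · intro β hβ
    rw [Finset.mem_erase] at hβ
    exact R.reflection_mem_inversions cs hβ.1 hβ.2
  · intro β hβ
    rw [Finset.mem_erase]
    refine ⟨hne β ((R.mem_inversions cs).1 hβ).1, ?_⟩
    have := R.reflection_mem_inversions cs (fun e ↦ hi' (e ▸ hβ)) hβ (i := i)
    rwa [cs.simple_mul_simple_cancel_left] at this
  · intro β _; exact invol β
  · intro β _; exact invol β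

theorem length_eq_card_inversions (w : W) : cs.length w = (R.inversions cs w).card := by
  induction hN : cs.length w generalizing w with
  | zero =>
    rw [cs.length_eq_zero_iff] at hN
    subst hN
    symm
    rw [Finset.card_eq_zero, Finset.eq_empty_iff_forall_notMem]
    intro β hβ
    rw [mem_inversions] at hβ
    refine R.neg_notMem_pos hβ.1 ?_
    simpa using hβ.2
  | succ N ih =>
    have hw : w ≠ 1 := by rintro rfl; simp at hN
    obtain ⟨i, hi⟩ := cs.exists_leftDescent_of_ne_one hw
    rw [R.card_inversions_simple_mul cs hi, ← ih]
    have := cs.isLeftDescent_iff.1 hi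
    omega

/-- The generators of W_I change x by multiples of simple roots in I, on which the coweights outside
I vanish. -/
theorem coweight_act_of_mem_parabolic {I : Set B} {w : W} (hw : w ∈ cs.parabolic I) {k : B}
    (hk : k ∉ I) (x : ι → ℚ) : R.coweight k ⬝ᵥ R.act cs w x = R.coweight k ⬝ᵥ x := by
  have key : ∀ i ∈ I, ∀ x, R.coweight k ⬝ᵥ R.act cs (cs.simple i) x = R.coweight k ⬝ᵥ x := by
    intro i hi x
    rw [act_simple_apply, dotProduct_sub, dotProduct_smul,
      R.coweight_root_of_ne k i (by rintro rfl; exact hk hi), smul_zero, sub_zero]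
  induction hw using Subgroup.closure_induction generalizing x with
  | mem w h => obtain ⟨i, hi, rfl⟩ := h; exact key i hi x
  | one => simp
  | mul v w _ _ hv hw => rw [act_mul_apply, hv, hw]
  | inv w _ hw => rw [← hw, act_apply_act_inv]

open Classical in
/-- The length of an element of `W_I` is at most the number of positive roots supported on `I`. -/
theorem lengthLongest_le (I : Set B) :
    cs.lengthLongest I ≤ {β ∈ R.pos | ∀ k ∉ I, R.coweight k ⬝ᵥ β = 0}.card := by
  refine csSup_le ⟨_, 1, one_mem _, rfl⟩ ?_
  rintro _ ⟨w, hw, rfl⟩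
  rw [R.length_eq_card_inversions cs]
  refine Finset.card_le_card fun β hβ ↦ ?_
  rw [mem_inversions] at hβ
  refine Finset.mem_filter.2 ⟨hβ.1, fun k hk ↦ le_antisymm ?_ (R.coweight_nonneg β hβ.1 k)⟩
  -- Both β and −w⁻¹β have a nonnegative k-th coordinate, while w⁻¹ preserves that coordinate; so it
  -- is 0.
  have := R.coweight_nonneg _ hβ.2 k
  rw [dotProduct_neg, R.coweight_act_of_mem_parabolic cs (inv_mem hw) hk] at this
  linarith

/-! ### Signs of roots and the second moment. -/

/-- For each positive root there is an element of the group acting as the reflection in it. -/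
theorem exists_act_eq_reflection {β : ι → ℚ} (hβ : β ∈ R.pos) :
    ∃ t : W, R.act cs t β = -β ∧ ∀ γ, β ⬝ᵥ γ = 0 → R.act cs t γ = γ := by
  obtain ⟨w, i, rfl⟩ : ∃ (w : W) (i : B), R.act cs w (R.root i) = β := by
    refine R.pos_subset {β | ∃ (w : W) (i : B), R.act cs w (R.root i) = β} ?_ ?_ β hβ
    · exact fun i ↦ ⟨1, i, by simp⟩
    · rintro i _ ⟨w, j, rfl⟩
      exact ⟨cs.simple i * w, j, by rw [act_mul_apply, act_simple]⟩
  refine ⟨w * cs.simple i * w⁻¹, ?_, fun γ hγ ↦ ?_⟩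
  · rw [act_mul_apply, act_mul_apply, act_inv_apply_act, act_simple, reflectionEquiv_root_self,
      map_neg]
  · rw [act_mul_apply, act_mul_apply, act_simple_apply, corootPairing_apply,
      ← R.dotProduct_act cs w, act_apply_act_inv, hγ]
    simp

open Classical in
/-- `-1` if `β` is an inversion of `w`, and `1` otherwise. -/
noncomputable def sign (w : W) (β : ι → ℚ) : ℝ := if -R.act cs w⁻¹ β ∈ R.pos then -1 else 1

theorem sign_neg_act {t w : W} {β : ι → ℚ} (hβ : β ∈ R.pos) (ht : R.act cs t⁻¹ β = -β) :
    R.sign cs (t * w) β = -R.sign cs w β := by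
  simp only [sign, mul_inv_rev, act_mul_apply, ht, map_neg, neg_neg,
    R.neg_act_mem_pos_iff cs _ hβ]
  split_ifs <;> simp_all

/-- Left multiplication by the reflection in β permutes W, flips the sign of β and keeps that of γ,
so the sum equals its own negative. -/
theorem sum_sign_mul_sign [Fintype W] {β γ : ι → ℚ} (hβ : β ∈ R.pos) (h : β ⬝ᵥ γ = 0) :
    ∑ w : W, R.sign cs w β * R.sign cs w γ = 0 := by
  obtain ⟨t, ht, ht'⟩ := R.exists_act_eq_reflection cs hβ
  have htβ : R.act cs t⁻¹ β = -β := by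
    have := R.act_inv_apply_act cs t β
    rw [ht, map_neg, neg_eq_iff_eq_neg] at this
    exact this
  have htγ : R.act cs t⁻¹ γ = γ := by
    have := R.act_inv_apply_act cs t γ
    rwa [ht' γ h] at this
  have e : ∑ w : W, R.sign cs (t * w) β * R.sign cs (t * w) γ =
      ∑ w : W, R.sign cs w β * R.sign cs w γ :=
    Equiv.sum_comp (Equiv.mulLeft t) fun w ↦ R.sign cs w β * R.sign cs w γ
  have e' : ∀ w, R.sign cs (t * w) γ = R.sign cs w γ := by
    intro w; simp only [sign, mul_inv_rev, act_mul_apply, htγ]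
  simp only [R.sign_neg_act cs hβ htβ, e', neg_mul, Finset.sum_neg_distrib] at e
  linarith

/-- In the expanded square, orthogonal pairs contribute 0 and every other pair at most |W|. -/
theorem sum_sq_sum_sign_le [Fintype W] {κ : Type*} [DecidableEq κ] (s : Finset κ)
    (f : κ → ι → ℚ) (hf : ∀ a ∈ s, f a ∈ R.pos) :
    ∑ w : W, (∑ a ∈ s, R.sign cs w (f a)) ^ 2 ≤
      Fintype.card W * {p ∈ s ×ˢ s | f p.1 ⬝ᵥ f p.2 ≠ 0}.card := by
  have e : ∀ w : W, (∑ a ∈ s, R.sign cs w (f a)) ^ 2 =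
      ∑ p ∈ s ×ˢ s, R.sign cs w (f p.1) * R.sign cs w (f p.2) := fun w ↦ by
    rw [sq, Finset.sum_mul_sum, ← Finset.sum_product']
  simp only [e]
  rw [Finset.sum_comm, Finset.card_filter, Nat.cast_sum, Finset.mul_sum]
  refine Finset.sum_le_sum fun p hp ↦ ?_
  rw [Finset.mem_product] at hp
  by_cases h : f p.1 ⬝ᵥ f p.2 = 0
  · simp [R.sum_sign_mul_sign cs (hf _ hp.1) h, h]
  · have : ∀ w ∈ (Finset.univ : Finset W), R.sign cs w (f p.1) * R.sign cs w (f p.2) ≤ 1 := by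
      intro w _
      simp only [sign]
      split_ifs <;> norm_num
    simpa [h] using Finset.sum_le_card_nsmul _ _ _ this

/-- Chebyshev's inequality for sums of signs. -/
theorem card_abs_sum_sign_ge_mul_le [Fintype W] {κ : Type*} [DecidableEq κ] (s : Finset κ)
    (f : κ → ι → ℚ) (hf : ∀ a ∈ s, f a ∈ R.pos) {δ : ℝ} (hδ : 0 ≤ δ) :
    (Nat.card {w : W // δ ≤ |∑ a ∈ s, R.sign cs w (f a)|} : ℝ) * δ ^ 2 ≤
      Nat.card W * {p ∈ s ×ˢ s | f p.1 ⬝ᵥ f p.2 ≠ 0}.card := by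
  classical
  rw [Nat.card_eq_fintype_card (α := W)]
  refine le_trans ?_ (R.sum_sq_sum_sign_le cs s f hf)
  rw [Nat.card_eq_fintype_card, Fintype.card_subtype, ← nsmul_eq_mul]
  refine (Finset.card_nsmul_le_sum _ _ _ fun w hw ↦ ?_).trans
    (Finset.sum_le_univ_sum_of_nonneg fun w ↦ sq_nonneg (∑ a ∈ s, R.sign cs w (f a)))
  rw [← sq_abs (∑ a ∈ s, R.sign cs w (f a))]
  exact pow_le_pow_left₀ hδ (Finset.mem_filter.1 hw).2 2

theorem two_mul_length (w : W) :
    2 * (cs.length w : ℝ) = R.pos.card - ∑ β ∈ R.pos, R.sign cs w β := by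
  classical
  rw [R.length_eq_card_inversions cs, inversions, Finset.card_filter, Nat.cast_sum,
    Finset.mul_sum, eq_sub_iff_add_eq, ← Finset.sum_add_distrib, Finset.card_eq_sum_ones,
    Nat.cast_sum]
  refine Finset.sum_congr rfl fun β _ ↦ ?_
  simp only [sign]
  split_ifs <;> norm_num

theorem two_mul_numLeftDescents [Fintype B] (w : W) :
    2 * (cs.numLeftDescents w : ℝ) = Fintype.card B - ∑ i, R.sign cs w (R.root i) := by
  classical
  have : cs.numLeftDescents w = ∑ i, if cs.IsLeftDescent w i then 1 else 0 := by
    rw [← Finset.card_filter, CoxeterSystem.numLeftDescents, ← Set.ncard_coe_finset]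
    simp
  rw [this, Nat.cast_sum, Finset.mul_sum, eq_sub_iff_add_eq, ← Finset.sum_add_distrib,
    ← Finset.card_univ, Finset.card_eq_sum_ones, Nat.cast_sum]
  refine Finset.sum_congr rfl fun i _ ↦ ?_
  simp only [sign, R.neg_act_inv_root_mem_pos_iff]
  split_ifs <;> norm_num

end CoxeterMatrix.RootModel

/-! ### The bound O(1/n) for root models with quadratically many positive roots. -/

namespace CoxeterMatrix.RootModel

variable {B : Type*} {M : CoxeterMatrix B} {ι : Type*} [Fintype ι] (R : M.RootModel ι)
variable {W : Type*} [Group W] (cs : CoxeterSystem M W)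

open Classical in
theorem maxw0_le [Fintype B] {c s : ℝ} (hc : 0 ≤ c) (hs : 0 ≤ s)
    (hsupp : ∀ I : Finset B,
      ({β ∈ R.pos | ∀ k ∉ I, R.coweight k ⬝ᵥ β = 0}.card : ℝ) ≤ c * (I.card ^ 2 + s)) (x : ℕ) :
    (cs.maxw0 x : ℝ) ≤ c * (x ^ 2 + s) := by
  -- The floor turns the real bound into a natural number, so that the supremum can be bounded one I
  -- at a time.
  rw [← Nat.le_floor_iff (by positivity), CoxeterSystem.maxw0, Finset.sup_le_iff]
  intro I hI
  rw [Nat.le_floor_iff (by positivity)]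
  have h1 := hsupp I
  rw [(Finset.mem_powersetCard.1 hI).2] at h1
  refine le_trans ?_ h1
  have := R.lengthLongest_le cs (I : Set B)
  simp only [Finset.mem_coe] at this
  exact_mod_cast this

open Classical in
/-- A proper element has few inversions or many descents. -/
theorem le_abs_sum_sign_of_isProper [Fintype B] {n : ℕ} (hB : Fintype.card B = n)
    (hn : 100 ≤ n) {c : ℝ} (hc : 1 / 2 ≤ c) (hpos : c * (n ^ 2 - n) ≤ R.pos.card)
    (hsupp : ∀ I : Finset B,
      ({β ∈ R.pos | ∀ k ∉ I, R.coweight k ⬝ᵥ β = 0}.card : ℝ) ≤ c * (I.card ^ 2 + n))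
    {w : W} (hw : cs.IsProper w) :
    c * n ^ 2 / 8 ≤ |∑ β ∈ R.pos, R.sign cs w β| ∨ (n : ℝ) / 8 ≤ |∑ i, R.sign cs w (R.root i)| := by
  by_contra! h
  have hl := R.two_mul_length cs w
  have hd := R.two_mul_numLeftDescents cs w
  have hm := R.maxw0_le cs (by linarith) (Nat.cast_nonneg n) hsupp (cs.numLeftDescents w)
  have h1 := (abs_lt.1 h.1).2
  have h2 := (abs_lt.1 h.2).1
  rw [CoxeterSystem.IsProper, hB] at hw
  have hw' : (cs.length w : ℝ) ≤ n + cs.maxw0 (cs.numLeftDescents w) := by exact_mod_cast hw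
  rw [hB] at hd
  set d : ℝ := (cs.numLeftDescents w : ℝ)
  -- The sign sum over the simple roots exceeds −n/8, so 2d < n + n/8.
  have hd' : d ≤ 9 / 16 * n := by linarith
  have hd0 : 0 ≤ d := Nat.cast_nonneg _
  have hd2 : d ^ 2 ≤ 81 / 256 * (n : ℝ) ^ 2 := by nlinarith
  have hn' : (100 : ℝ) ≤ n := by exact_mod_cast hn
  have h3 : c * (d ^ 2 + n) ≤ c * (81 / 256 * (n : ℝ) ^ 2 + n) := by gcongr
  -- The left side is half of c(n² − n) − cn²/8, a lower bound for ℓ(w).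
  have h4 : c * (7 / 16 * (n : ℝ) ^ 2 - n / 2) ≤ n + c * (81 / 256 * (n : ℝ) ^ 2 + n) := by
    linarith
  have h5 : c * (31 / 256 * (n : ℝ) ^ 2 - 3 / 2 * n) ≤ n := by linarith
  -- Here n ≥ 100 is used, and 31/256 = 7/16 − 81/256. With c ≥ 1/2, `h5` then gives 4n ≤ n.
  have h6 : 8 * (n : ℝ) ≤ 31 / 256 * (n : ℝ) ^ 2 - 3 / 2 * n := by nlinarith
  nlinarith

-- Chebyshev is applied with the thresholds cn²/8 ≥ n²/16 and n/8; their squares produce the factors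
-- 256 and 64.
open Classical in
theorem properProbability_le [Fintype B] {n : ℕ} (hB : Fintype.card B = n)
    (hn : 100 ≤ n) {c K K' : ℝ} (hc : 1 / 2 ≤ c)
    (hpos : c * (n ^ 2 - n) ≤ R.pos.card)
    (hsupp : ∀ I : Finset B,
      ({β ∈ R.pos | ∀ k ∉ I, R.coweight k ⬝ᵥ β = 0}.card : ℝ) ≤ c * (I.card ^ 2 + n))
    (hrel : ({p ∈ R.pos ×ˢ R.pos | p.1 ⬝ᵥ p.2 ≠ 0}.card : ℝ) ≤ K * n ^ 3)
    (hrel' : ({p : B × B | R.root p.1 ⬝ᵥ R.root p.2 ≠ 0} : Finset (B × B)).card ≤ K' * n) :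
    cs.properProbability ≤ (256 * K + 64 * K') / n := by
  have := R.finite cs
  have := Fintype.ofFinite W
  have hn' : (100 : ℝ) ≤ n := by exact_mod_cast hn
  have hn0 : (0 : ℝ) < n := by linarith
  have hW : (0 : ℝ) < Nat.card W := by exact_mod_cast Nat.card_pos
  have c1 := R.card_abs_sum_sign_ge_mul_le cs R.pos id (fun _ h ↦ h)
    (δ := c * n ^ 2 / 8) (by positivity)
  have c2 := R.card_abs_sum_sign_ge_mul_le cs Finset.univ R.root (fun i _ ↦ R.root_mem_pos i)
    (δ := n / 8) (by positivity)
  rw [Finset.univ_product_univ] at c2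
  simp only [id] at c1
  have c3 : Nat.card {w : W // cs.IsProper w} ≤
      Nat.card {w : W // c * n ^ 2 / 8 ≤ |∑ β ∈ R.pos, R.sign cs w β|} +
      Nat.card {w : W // (n : ℝ) / 8 ≤ |∑ i, R.sign cs w (R.root i)|} := by
    simp only [Nat.card_eq_fintype_card, Fintype.card_subtype]
    refine le_trans (Finset.card_le_card fun w hw ↦ ?_) (Finset.card_union_le _ _)
    simpa using R.le_abs_sum_sign_of_isProper cs hB hn hc hpos hsupp (Finset.mem_filter.1 hw).2
  set N : ℝ := (Nat.card W : ℝ)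
  set x : ℝ := (Nat.card {w : W // c * n ^ 2 / 8 ≤ |∑ β ∈ R.pos, R.sign cs w β|} : ℝ)
  set y : ℝ := (Nat.card {w : W // (n : ℝ) / 8 ≤ |∑ i, R.sign cs w (R.root i)|} : ℝ)
  have c3' : (Nat.card {w : W // cs.IsProper w} : ℝ) ≤ x + y :=
    (Nat.cast_le.2 c3).trans_eq (Nat.cast_add _ _)
  have hx : x ≤ N * (256 * K) / n := by
    have h1 : x * (n ^ 2 / 16) ^ 2 ≤ x * (c * n ^ 2 / 8) ^ 2 := by
      gcongr x * ?_ ^ 2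
      nlinarith [sq_nonneg (n : ℝ)]
    have h2 : x * (n ^ 2 / 16) ^ 2 ≤ N * (K * n ^ 3) :=
      h1.trans (c1.trans (by gcongr))
    rw [le_div_iff₀ hn0]
    have h3 : (x * n - N * (256 * K)) * ((n : ℝ) ^ 3 / 256) ≤ 0 := by linarith
    have := nonpos_of_mul_nonpos_left h3 (by positivity)
    linarith
  have hy : y ≤ N * (64 * K') / n := by
    have h2 : y * (n / 8) ^ 2 ≤ N * (K' * n) := c2.trans (by gcongr)
    rw [le_div_iff₀ hn0]
    have h3 : (y * n - N * (64 * K')) * ((n : ℝ) / 64) ≤ 0 := by linarith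
    have := nonpos_of_mul_nonpos_left h3 (by positivity)
    linarith
  rw [CoxeterSystem.properProbability, div_le_iff₀ hW]
  calc _ ≤ x + y := c3'
    _ ≤ N * (256 * K) / n + N * (64 * K') / n := add_le_add hx hy
    _ = _ := by ring

end CoxeterMatrix.RootModel

theorem CoxeterSystem.properProbability_nonneg {B : Type*} [Fintype B] {M : CoxeterMatrix B}
    {W : Type*} [Group W] (cs : CoxeterSystem M W) : 0 ≤ cs.properProbability := by
  rw [properProbability]; positivity

theorem tendsto_zero_of_le_const_div {f : ℕ → ℝ} (C : ℝ) (N : ℕ) (h0 : ∀ n, 0 ≤ f n)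
    (h : ∀ n, N ≤ n → f n ≤ C / n) : Tendsto f atTop (𝓝 0) :=
  squeeze_zero' (Eventually.of_forall h0) (eventually_atTop.2 ⟨N, h⟩)
    (tendsto_const_div_atTop_nhds_zero_nat C)

/-! ### The vectors e_b − e_a, e_a + e_b and e_a. -/

section SignedVectors

variable {m : ℕ}

/-- The standard basis vector of index `a`. -/
abbrev basisVec (a : Fin m) : Fin m → ℚ := Pi.single a 1

theorem corootPairing_sub {a b : Fin m} (h : a ≠ b) (x : Fin m → ℚ) :
    corootPairing (basisVec b - basisVec a) x = x b - x a := by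
  rw [corootPairing_apply]
  simp [sub_dotProduct, dotProduct_sub, h, h.symm]
  ring

theorem corootPairing_add {a b : Fin m} (h : a ≠ b) (x : Fin m → ℚ) :
    corootPairing (basisVec a + basisVec b) x = x a + x b := by
  rw [corootPairing_apply]
  simp [add_dotProduct, dotProduct_add, h, h.symm]
  ring

theorem corootPairing_basisVec (a : Fin m) (x : Fin m → ℚ) :
    corootPairing (basisVec a) x = 2 * x a := by
  rw [corootPairing_apply]
  simp

theorem reflectionEquiv_sub_basisVec {a b : Fin m} (h : a ≠ b) (c : Fin m) :
    reflectionEquiv (basisVec b - basisVec a) (basisVec c) = basisVec (Equiv.swap a b c) := by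
  rw [reflectionEquiv_apply, corootPairing_sub h]
  rcases eq_or_ne c a with rfl | ha
  · rw [Equiv.swap_apply_left]
    simp [h]
  rcases eq_or_ne c b with rfl | hb
  · rw [Equiv.swap_apply_right]
    simp [h.symm]
  · rw [Equiv.swap_apply_of_ne_of_ne ha hb]
    simp [ha.symm, hb.symm]

theorem reflectionEquiv_add_basisVec {a b : Fin m} (h : a ≠ b) (c : Fin m) :
    reflectionEquiv (basisVec a + basisVec b) (basisVec c) =
      if c = a then -basisVec b else if c = b then -basisVec a else basisVec c := by
  rw [reflectionEquiv_apply, corootPairing_add h]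
  split_ifs with ha hb
  · subst ha; simp [h]
  · subst hb; simp [h.symm]
  · simp [Ne.symm ha, Ne.symm hb]

theorem reflectionEquiv_basisVec (a c : Fin m) :
    reflectionEquiv (basisVec a) (basisVec c) = if c = a then -basisVec a else basisVec c := by
  rw [reflectionEquiv_apply, corootPairing_basisVec]
  split_ifs with ha
  · subst ha; simp; module
  · simp [Ne.symm ha]

/-- The positive roots of type `B`, indexed by ordered pairs: `e b - e a` for `a < b`, `e a + e b`
for `b < a`, and `e a` for `a = b`. The pairs with `a < b` give those of type `A`, and the pairs
with `a ≠ b` those of type `D`. -/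
def signedRoot (p : Fin m × Fin m) : Fin m → ℚ :=
  if p.1 < p.2 then basisVec p.2 - basisVec p.1
  else if p.2 < p.1 then basisVec p.1 + basisVec p.2 else basisVec p.1

theorem signedRoot_of_lt {a b : Fin m} (h : a < b) :
    signedRoot (a, b) = basisVec b - basisVec a := by
  simp [signedRoot, h]

theorem signedRoot_of_gt {a b : Fin m} (h : b < a) :
    signedRoot (a, b) = basisVec a + basisVec b := by
  simp [signedRoot, h, h.not_gt]

theorem signedRoot_self (a : Fin m) : signedRoot (a, a) = basisVec a := by
  simp [signedRoot]

theorem dotProduct_signedRoot (x : Fin m → ℚ) (p : Fin m × Fin m) :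
    x ⬝ᵥ signedRoot p = if p.1 < p.2 then x p.2 - x p.1
      else if p.2 < p.1 then x p.1 + x p.2 else x p.1 := by
  rw [signedRoot]
  split_ifs <;> simp [dotProduct_sub, dotProduct_add]

theorem signedRoot_injective : Function.Injective (signedRoot (m := m)) := by
  rintro ⟨a, b⟩ ⟨c, d⟩ h
  -- The coordinate sum is 0, 2 or 1 for differences, sums and single basis vectors, so it
  -- determines the kind.
  have hs := congrArg (fun x ↦ (1 : Fin m → ℚ) ⬝ᵥ x) h
  have ha := congrFun h a
  have hb := congrFun h b
  simp only [dotProduct_signedRoot, Pi.one_apply] at hs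
  have kind : (a < b ↔ c < d) ∧ (b < a ↔ d < c) := by
    split_ifs at hs <;> first | (exfalso; norm_num at hs; done) | (constructor <;> omega)
  rcases lt_trichotomy a b with h1 | rfl | h1
  · have h2 := kind.1.1 h1
    simp only [signedRoot, h1, h2, if_true, Pi.sub_apply, Pi.single_apply, h1.ne, h1.ne',
      if_false, sub_zero, zero_sub] at ha hb
    have h3 : b = d := by
      by_contra hne
      rw [if_neg hne] at hb
      split_ifs at hb <;> norm_num at hb
    have h4 : a = c := by
      by_contra hne
      rw [if_neg hne] at ha
      split_ifs at ha <;> norm_num at ha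
    rw [h3, h4]
  · have h2 : c = d := by omega
    subst h2
    simp [signedRoot, Pi.single_apply] at ha
    rw [ha]
  · have h2 := kind.2.1 h1
    simp only [signedRoot, h1, h2, h1.not_gt, h2.not_gt, if_true, if_false, Pi.add_apply,
      Pi.single_apply, h1.ne, h1.ne'] at ha hb
    have h3 : a = c ∨ a = d := by
      by_contra! hne
      simp [hne.1, hne.2] at ha
    have h4 : b = c ∨ b = d := by
      by_contra! hne
      simp [hne.1, hne.2] at hb
    rw [Prod.mk.injEq]
    omega

/-- Vectors without a common index have disjoint supports. -/
theorem signedRoot_dotProduct_ne_zero {p q : Fin m × Fin m}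
    (h : signedRoot p ⬝ᵥ signedRoot q ≠ 0) : p.1 = q.1 ∨ p.1 = q.2 ∨ p.2 = q.1 ∨ p.2 = q.2 := by
  contrapose! h
  obtain ⟨h1, h2, h3, h4⟩ := h
  have h5 : ∀ c, p.1 ≠ c → p.2 ≠ c → signedRoot p c = 0 := by
    intro c hc hc'
    rw [signedRoot]
    split_ifs <;> simp [hc.symm, hc'.symm]
  rw [dotProduct_signedRoot, h5 _ h1 h3, h5 _ h2 h4]
  simp

/-- A non-orthogonal pair shares an index in one of four positions, which leaves three free indices.
-/
theorem card_signedRoot_dotProduct_ne_zero_le (P : Finset (Fin m × Fin m)) :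
    ((P.image signedRoot ×ˢ P.image signedRoot).filter fun p ↦ p.1 ⬝ᵥ p.2 ≠ 0).card ≤
      4 * m ^ 3 := by
  have key : ((P.image signedRoot ×ˢ P.image signedRoot).filter fun p ↦ p.1 ⬝ᵥ p.2 ≠ 0) ⊆
      (((Finset.univ.image fun t : Fin m × Fin m × Fin m ↦
          (signedRoot (t.1, t.2.1), signedRoot (t.1, t.2.2))) ∪
        (Finset.univ.image fun t : Fin m × Fin m × Fin m ↦
          (signedRoot (t.1, t.2.1), signedRoot (t.2.2, t.1)))) ∪
        (Finset.univ.image fun t : Fin m × Fin m × Fin m ↦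
          (signedRoot (t.2.1, t.1), signedRoot (t.1, t.2.2)))) ∪
        (Finset.univ.image fun t : Fin m × Fin m × Fin m ↦
          (signedRoot (t.2.1, t.1), signedRoot (t.2.2, t.1))) := by
    rintro ⟨x, y⟩ hxy
    simp only [Finset.mem_filter, Finset.mem_product, Finset.mem_image] at hxy
    obtain ⟨⟨⟨⟨a, b⟩, -, rfl⟩, ⟨c, d⟩, -, rfl⟩, h⟩ := hxy
    simp only [Finset.mem_union, Finset.mem_image, Finset.mem_univ, true_and]
    rcases signedRoot_dotProduct_ne_zero h with h | h | h | h <;> dsimp only at h <;> subst h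
    · exact Or.inl (Or.inl (Or.inl ⟨(a, b, d), rfl⟩))
    · exact Or.inl (Or.inl (Or.inr ⟨(a, b, c), rfl⟩))
    · exact Or.inl (Or.inr ⟨(b, a, d), rfl⟩)
    · exact Or.inr ⟨(b, a, c), rfl⟩
  have bound : ∀ f : Fin m × Fin m × Fin m → (Fin m → ℚ) × (Fin m → ℚ),
      (Finset.univ.image f).card ≤ m ^ 3 := by
    intro f
    refine Finset.card_image_le.trans (le_of_eq ?_)
    simp only [Finset.card_univ, Fintype.card_prod, Fintype.card_fin]
    ring
  refine (Finset.card_le_card key).trans ?_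
  refine (Finset.card_union_le _ _).trans ?_
  refine (Nat.add_le_add_right (Finset.card_union_le _ _) _).trans ?_
  refine (Nat.add_le_add_right (Nat.add_le_add_right (Finset.card_union_le _ _) _) _).trans ?_
  have := bound fun t ↦ (signedRoot (t.1, t.2.1), signedRoot (t.1, t.2.2))
  have := bound fun t ↦ (signedRoot (t.1, t.2.1), signedRoot (t.2.2, t.1))
  have := bound fun t ↦ (signedRoot (t.2.1, t.1), signedRoot (t.1, t.2.2))
  have := bound fun t ↦ (signedRoot (t.2.1, t.1), signedRoot (t.2.2, t.1))
  omega

/-- An adjacent transposition preserves the order of all other pairs. -/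
theorem swap_lt_swap {a b c d : Fin m} (hab : (a : ℕ) + 1 = b) (hcd : c < d)
    (hne : ¬(c = a ∧ d = b)) : Equiv.swap a b c < Equiv.swap a b d := by
  simp only [Equiv.swap_apply_def]
  split_ifs <;> simp only [Fin.ext_iff, Fin.lt_def] at * <;> omega

/-- Membership propagates along adjacent transpositions. -/
theorem mem_of_adjacent_reflections {S : Set (Fin m → ℚ)} {f : Fin m → Fin m → ℚ} {s t : Fin m}
    (hS : ∀ a b : Fin m, (a : ℕ) + 1 = b → ∀ x ∈ S,
      reflectionEquiv (basisVec b - basisVec a) x ∈ S)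
    (hf : ∀ a b : Fin m, (a : ℕ) + 1 = b → s ≤ a → b ≤ t →
      reflectionEquiv (basisVec b - basisVec a) (f a) = f b)
    (h : f s ∈ S) {c : Fin m} (hsc : s ≤ c) (hct : c ≤ t) : f c ∈ S := by
  obtain ⟨c, hc⟩ := c
  induction c with
  | zero =>
    have : s = ⟨0, hc⟩ := le_antisymm hsc (Fin.mk_le_of_le_val (Nat.zero_le _))
    rwa [← this]
  | succ c ih =>
    rcases hsc.eq_or_lt with rfl | hlt
    · exact h
    have hsc' : s ≤ ⟨c, by omega⟩ := by
      rw [Fin.lt_def] at hlt; rw [Fin.le_def]; exact Nat.le_of_lt_succ hlt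
    rw [← hf ⟨c, by omega⟩ ⟨c + 1, hc⟩ rfl hsc' hct]
    exact hS _ _ rfl _ (ih _ hsc' (le_trans (Fin.mk_le_mk.2 (Nat.le_succ c)) hct))

/-- Start at e_{a+1} − e_a and raise the upper index; the reflections used involve only indices
above a and fix e_a. -/
theorem sub_mem_of_adjacent_reflections {S : Set (Fin m → ℚ)}
    (hS : ∀ a b : Fin m, (a : ℕ) + 1 = b → ∀ x ∈ S,
      reflectionEquiv (basisVec b - basisVec a) x ∈ S)
    (h : ∀ a b : Fin m, (a : ℕ) + 1 = b → basisVec b - basisVec a ∈ S) {a b : Fin m}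
    (hab : a < b) : basisVec b - basisVec a ∈ S := by
  have ha : (a : ℕ) + 1 < m := lt_of_le_of_lt hab b.2
  refine mem_of_adjacent_reflections (f := fun c ↦ basisVec c - basisVec a) (s := ⟨a + 1, ha⟩)
    (t := b) hS ?_ (h _ _ rfl) hab le_rfl
  intro c d hcd hac _
  have hac' : (a : ℕ) + 1 ≤ c := hac
  rw [map_sub, reflectionEquiv_sub_basisVec (by rintro rfl; omega),
    reflectionEquiv_sub_basisVec (by rintro rfl; omega), Equiv.swap_apply_left,
    Equiv.swap_apply_of_ne_of_ne (by rintro rfl; omega) (by rintro rfl; omega)]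

/-- Raising both indices of `e a + e b`. -/
theorem add_mem_of_adjacent_reflections {S : Set (Fin m → ℚ)}
    (hS : ∀ a b : Fin m, (a : ℕ) + 1 = b → ∀ x ∈ S,
      reflectionEquiv (basisVec b - basisVec a) x ∈ S)
    (h : ∀ a b : Fin m, (a : ℕ) = 0 → a < b → basisVec b + basisVec a ∈ S) {a b : Fin m}
    (hab : a < b) : basisVec b + basisVec a ∈ S := by
  have hm : 0 < m := a.pos
  -- The lower index climbs from 0 to a; these reflections involve only indices below b and fix e_b.
  refine mem_of_adjacent_reflections (f := fun c ↦ basisVec b + basisVec c) (s := ⟨0, hm⟩)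
    (t := a) hS ?_ (h _ _ rfl (lt_of_le_of_lt (Nat.zero_le _) hab)) (Nat.zero_le _) le_rfl
  intro c d hcd _ hda
  have hda' : (d : ℕ) ≤ a := hda
  have hab' : (a : ℕ) < b := hab
  rw [map_add, reflectionEquiv_sub_basisVec (by rintro rfl; omega),
    reflectionEquiv_sub_basisVec (by rintro rfl; omega), Equiv.swap_apply_left,
    Equiv.swap_apply_of_ne_of_ne (by rintro rfl; omega) (by rintro rfl; omega)]

/-- Joined nodes in the diagrams have indices at most 2 apart, with 2 occurring at the fork of D, so
this bounds the non-orthogonal pairs of simple roots linearly. -/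
theorem card_near_diagonal_le (n : ℕ) :
    (Finset.univ.filter fun p : Fin n × Fin n ↦
      (p.1 : ℕ) ≤ p.2 + 2 ∧ (p.2 : ℕ) ≤ p.1 + 2).card ≤ 5 * n := by
  have : (Finset.univ ×ˢ Finset.range 5 : Finset (Fin n × ℕ)).card = 5 * n := by
    simp [mul_comm]
  rw [← this]
  refine Finset.card_le_card_of_injOn (fun p ↦ (p.1, (p.2 : ℕ) + 2 - p.1)) ?_ ?_
  · rintro ⟨i, j⟩ h
    simp only [Finset.coe_filter, Finset.mem_univ, true_and, Set.mem_ofPred_eq] at h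
    simp only [Finset.coe_product, Set.mem_prod, Finset.mem_coe, Finset.mem_univ, true_and,
      Finset.mem_range]
    omega
  · rintro ⟨i, j⟩ h ⟨i', j'⟩ h' e
    simp only [Finset.coe_filter, Finset.mem_univ, true_and, Set.mem_ofPred_eq] at h h'
    simp only [Prod.mk.injEq] at e ⊢
    obtain ⟨rfl, e⟩ := e
    refine ⟨rfl, Fin.ext ?_⟩
    omega

end SignedVectors

theorem CoxeterMatrix.RootModel.root_dotProduct_eq_zero {B : Type*} {M : CoxeterMatrix B}
    {ι : Type*} [Fintype ι] (R : M.RootModel ι) {i j : B} (h : M i j = 2) :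
    R.root i ⬝ᵥ R.root j = 0 := by
  have hij : i ≠ j := by rintro rfl; simp at h
  obtain ⟨p, q, -, -, hp, -, ⟨-, rfl, -⟩ | ⟨h', -⟩ | ⟨h', -⟩⟩ := R.cartan i j hij
  · rw [corootPairing_apply, neg_zero, div_eq_zero_iff] at hp
    simpa [R.root_dotProduct_self_ne_zero] using hp
  · omega
  · omega

open Classical in
/-- Convergence for root models on signed vectors with quadratically many roots. -/
theorem tendsto_properProbability_of_signedRoot (M : ∀ n, CoxeterMatrix (Fin n)) {m : ℕ → ℕ}
    (N : ℕ) (R : ∀ n, N ≤ n → (M n).RootModel (Fin (m n))) (P : ∀ n, Finset (Fin (m n) × Fin (m n)))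
    {c : ℝ} (hc : 1 / 2 ≤ c)
    (hm : ∀ n, m n ≤ n + 1) (hP : ∀ n (hn : N ≤ n), (R n hn).pos = (P n).image signedRoot)
    (hcard : ∀ n, N ≤ n → c * (n ^ 2 - n) ≤ (P n).card)
    (hsupp : ∀ n (hn : N ≤ n), ∀ I : Finset (Fin n),
      ({p ∈ P n | ∀ k ∉ I, (R n hn).coweight k ⬝ᵥ signedRoot p = 0}.card : ℝ) ≤
        c * (I.card ^ 2 + n))
    (hM : ∀ n, ∀ i j : Fin n, M n i j ≠ 2 → (i : ℕ) ≤ j + 2 ∧ (j : ℕ) ≤ i + 2)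
    (W : ℕ → Type u) [∀ n, Group (W n)] (cs : ∀ n, CoxeterSystem (M n) (W n)) :
    Tendsto (fun n ↦ (cs n).properProbability) atTop (𝓝 0) := by
  -- The 32 is from 4(n + 1)³ ≤ 4(2n)³, the 5 from the width of the band around the diagonal.
  refine tendsto_zero_of_le_const_div (256 * 32 + 64 * 5) (N + 100)
    (fun n ↦ (cs n).properProbability_nonneg) fun n hn' ↦ ?_
  have hn : N ≤ n := by omega
  refine (R n hn).properProbability_le (cs n) (Fintype.card_fin n) (by omega) hc
    ?_ ?_ ?_ ?_
  · rw [hP n hn, Finset.card_image_of_injective _ signedRoot_injective]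
    exact hcard n hn
  · intro I
    refine le_trans ?_ (hsupp n hn I)
    refine Nat.cast_le.2 ((Finset.card_le_card fun β hβ ↦ ?_).trans
      (Finset.card_image_le (f := signedRoot)))
    simp only [hP n hn, Finset.mem_filter, Finset.mem_image] at hβ ⊢
    obtain ⟨⟨p, hp, rfl⟩, hβ⟩ := hβ
    exact ⟨p, ⟨hp, hβ⟩, rfl⟩
  · have h1 := card_signedRoot_dotProduct_ne_zero_le (P n)
    have h2 : 4 * m n ^ 3 ≤ 4 * (2 * n) ^ 3 := by
      have := hm n
      gcongr
      omega
    rw [hP n hn]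
    calc _ ≤ ((4 * (2 * n) ^ 3 : ℕ) : ℝ) := by
          refine Nat.cast_le.2 (le_trans (le_of_eq ?_) (h1.trans h2))
          congr!
      _ = 32 * n ^ 3 := by push_cast; ring
  · have := card_near_diagonal_le n
    refine le_trans (Nat.cast_le.2 (Finset.card_le_card (t := Finset.univ.filter
      fun p : Fin n × Fin n ↦ (p.1 : ℕ) ≤ p.2 + 2 ∧ (p.2 : ℕ) ≤ p.1 + 2) fun p hp ↦ ?_))
      (by exact_mod_cast this)
    simp only [Finset.mem_filter, Finset.mem_univ, true_and] at hp ⊢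
    exact hM n _ _ fun h ↦ hp ((R n hn).root_dotProduct_eq_zero h)

/-! ### Adjacent transpositions acting on signed vectors. -/

section Chain

variable {m : ℕ}

/-- The reflection in `e b - e a`, for adjacent `a` and `b`, permutes the other vectors
`signedRoot p` and preserves their kind. -/
theorem exists_reflectionEquiv_signedRoot {a b : Fin m} (hab : (a : ℕ) + 1 = b)
    {p : Fin m × Fin m} (hp : signedRoot p ≠ basisVec b - basisVec a) :
    ∃ p' : Fin m × Fin m, (p'.1 < p'.2 ↔ p.1 < p.2) ∧ (p'.2 < p'.1 ↔ p.2 < p.1) ∧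
      reflectionEquiv (basisVec b - basisVec a) (signedRoot p) = signedRoot p' := by
  have hne : a ≠ b := by rintro rfl; omega
  have hlt : a < b := by rw [Fin.lt_def]; omega
  obtain ⟨c, d⟩ := p
  have hcd : ¬(c = a ∧ d = b) := by
    rintro ⟨rfl, rfl⟩
    exact hp (signedRoot_of_lt hlt)
  rcases lt_trichotomy c d with h | rfl | h
  · have h' := swap_lt_swap hab h hcd
    refine ⟨(Equiv.swap a b c, Equiv.swap a b d), by simp [h, h'],
      by simp [h.not_gt, h'.not_gt], ?_⟩
    rw [signedRoot_of_lt h, signedRoot_of_lt h', map_sub, reflectionEquiv_sub_basisVec hne,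
      reflectionEquiv_sub_basisVec hne]
  · exact ⟨(Equiv.swap a b c, Equiv.swap a b c), by simp, by simp, by
      rw [signedRoot_self, signedRoot_self, reflectionEquiv_sub_basisVec hne]⟩
  · have h' : Equiv.swap a b d ≠ Equiv.swap a b c := (Equiv.injective _).ne h.ne
    rcases lt_or_gt_of_ne h' with h' | h'
    · refine ⟨(Equiv.swap a b c, Equiv.swap a b d), by simp [h.not_gt, h'.not_gt],
        by simp [h, h'], ?_⟩
      rw [signedRoot_of_gt h, signedRoot_of_gt h', map_add, reflectionEquiv_sub_basisVec hne,
        reflectionEquiv_sub_basisVec hne]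
    -- The swap reverses the order only for {c, d} = {a, b}; since e_c + e_d is symmetric, the
    -- entries can be exchanged back.
    · refine ⟨(Equiv.swap a b d, Equiv.swap a b c), by simp [h.not_gt, h'.not_gt],
        by simp [h, h'], ?_⟩
      rw [signedRoot_of_gt h, signedRoot_of_gt h', map_add, reflectionEquiv_sub_basisVec hne,
        reflectionEquiv_sub_basisVec hne, add_comm]

theorem corootPairing_adjacent {a b c d : Fin m} (hab : (a : ℕ) + 1 = b) (hcd : (c : ℕ) + 1 = d)
    (hac : a ≠ c) : corootPairing (basisVec b - basisVec a) (basisVec d - basisVec c) =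
      -(if b = c ∨ d = a then 1 else 0) := by
  rw [corootPairing_sub (by rintro rfl; omega)]
  simp only [Pi.sub_apply, Pi.single_apply]
  split_ifs <;> first | (exfalso; omega) | norm_num

theorem sub_mem_image_signedRoot {P : Finset (Fin m × Fin m)} {a b : Fin m} (h : a < b)
    (hP : (a, b) ∈ P) : basisVec b - basisVec a ∈ P.image signedRoot :=
  Finset.mem_image.2 ⟨_, hP, signedRoot_of_lt h⟩

theorem add_mem_image_signedRoot {P : Finset (Fin m × Fin m)} {a b : Fin m} (h : a ≠ b)
    (hP : (a, b) ∈ P) (hP' : (b, a) ∈ P) : basisVec a + basisVec b ∈ P.image signedRoot := by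
  rcases lt_or_gt_of_ne h with h | h
  · exact Finset.mem_image.2 ⟨_, hP', (signedRoot_of_gt h).trans (add_comm _ _)⟩
  · exact Finset.mem_image.2 ⟨_, hP, signedRoot_of_gt h⟩

theorem basisVec_mem_image_signedRoot {P : Finset (Fin m × Fin m)} {a : Fin m}
    (hP : (a, a) ∈ P) : basisVec a ∈ P.image signedRoot :=
  Finset.mem_image.2 ⟨_, hP, signedRoot_self a⟩

end Chain

/-! ### Type A. -/

section TypeA

theorem CoxeterMatrix.A_apply (n : ℕ) (i j : Fin n) : CoxeterMatrix.A n i j =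
    if i = j then 1 else if (j : ℕ) + 1 = i ∨ (i : ℕ) + 1 = j then 3 else 2 := rfl

/-- The root model of type `A n`. -/
def rootModelA (n : ℕ) : (CoxeterMatrix.A n).RootModel (Fin (n + 1)) where
  root k := basisVec k.succ - basisVec k.castSucc
  -- On e_b − e_a with a < b this is 1 exactly for a ≤ k < b, the coefficient of the k-th simple
  -- root.
  coweight k j := if (k : ℕ) < j then 1 else 0
  pos := (Finset.univ.filter fun p : Fin (n + 1) × Fin (n + 1) ↦ p.1 < p.2).image signedRoot
  coweight_root_self i := by simp [dotProduct_sub]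
  coweight_root_of_ne i j hij := by
    simp only [dotProduct_sub, dotProduct_single, Fin.val_succ, Fin.val_castSucc]
    split_ifs <;> first | (exfalso; omega) | norm_num
  cartan i j hij := by
    refine ⟨_, _, ?_, ?_, corootPairing_adjacent (by simp) (by simp) (by simpa using hij),
      corootPairing_adjacent (by simp) (by simp) (by simpa using hij.symm), ?_⟩
    · split_ifs <;> norm_num
    · split_ifs <;> norm_num
    · rw [CoxeterMatrix.A_apply, if_neg hij]
      simp only [Fin.ext_iff, Fin.val_succ, Fin.val_castSucc] at hij ⊢
      split_ifs <;> first | (exfalso; omega) | norm_num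
  root_mem_pos i := sub_mem_image_signedRoot (Fin.castSucc_lt_succ) (by simp)
  coweight_nonneg := by
    simp only [Finset.mem_image, Finset.mem_filter, Finset.mem_univ, true_and]
    rintro _ ⟨p, hp, rfl⟩ k
    rw [dotProduct_signedRoot, if_pos hp]
    split_ifs <;> first | (exfalso; omega) | norm_num
  exists_coweight_pos := by
    simp only [Finset.mem_image, Finset.mem_filter, Finset.mem_univ, true_and]
    rintro _ ⟨p, hp, rfl⟩
    refine ⟨⟨p.1, by omega⟩, ?_⟩
    rw [dotProduct_signedRoot, if_pos hp]
    simp [hp]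
  reflection_mem_pos := by
    simp only [Finset.mem_image, Finset.mem_filter, Finset.mem_univ, true_and]
    rintro _ ⟨p, hp, rfl⟩ i hne
    obtain ⟨p', h, -, e⟩ := exists_reflectionEquiv_signedRoot (by simp) hne
    exact ⟨p', h.2 hp, e.symm⟩
  pos_subset S hroot hS := by
    simp only [Finset.mem_image, Finset.mem_filter, Finset.mem_univ, true_and]
    rintro _ ⟨p, hp, rfl⟩
    rw [signedRoot_of_lt hp]
    have node : ∀ a b : Fin (n + 1), (a : ℕ) + 1 = b → ∃ k : Fin n,
        basisVec b - basisVec a = basisVec k.succ - basisVec k.castSucc := by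
      intro a b hab
      have ha : (a : ℕ) < n := by omega
      have h1 : b = Fin.succ ⟨a, ha⟩ := Fin.ext (by simp [hab])
      exact ⟨⟨a, ha⟩, by rw [h1]; rfl⟩
    refine sub_mem_of_adjacent_reflections ?_ ?_ hp
    · intro a b hab x hx
      obtain ⟨k, hk⟩ := node a b hab
      rw [hk]
      exact hS k x hx
    · intro a b hab
      obtain ⟨k, hk⟩ := node a b hab
      rw [hk]
      exact hroot k

theorem two_mul_card_filter_lt_add (n : ℕ) :
    2 * (Finset.univ.filter fun p : Fin n × Fin n ↦ p.1 < p.2).card + n = n ^ 2 := by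
  have h1 : (Finset.univ.filter fun p : Fin n × Fin n ↦ p.1 < p.2).card =
      (Finset.univ.filter fun p : Fin n × Fin n ↦ p.2 < p.1).card :=
    Finset.card_bij' (fun p _ ↦ p.swap) (fun p _ ↦ p.swap) (by simp) (by simp) (by simp) (by simp)
  have h2 : (Finset.univ.filter fun p : Fin n × Fin n ↦ p.1 = p.2).card = n := by
    rw [show (Finset.univ.filter fun p : Fin n × Fin n ↦ p.1 = p.2) =
      (Finset.univ : Finset (Fin n)).diag by ext; simp, Finset.diag_card, Finset.card_univ,
      Fintype.card_fin]
  have h3 := Finset.card_filter_add_card_filter_not (s := (Finset.univ : Finset (Fin n × Fin n)))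
    (fun p ↦ p.1 < p.2)
  have h4 : (Finset.univ.filter fun p : Fin n × Fin n ↦ ¬p.1 < p.2) =
      (Finset.univ.filter fun p : Fin n × Fin n ↦ p.2 < p.1) ∪
        (Finset.univ.filter fun p : Fin n × Fin n ↦ p.1 = p.2) := by
    ext p; simp only [Finset.mem_filter, Finset.mem_univ, true_and, Finset.mem_union]; omega
  rw [h4, Finset.card_union_of_disjoint, h2, ← h1, Finset.card_univ, Fintype.card_prod,
    Fintype.card_fin] at h3
  · linarith
  · rw [Finset.disjoint_filter]; intro p _ h h'; omega

theorem two_mul_card_prod_filter_le {n : ℕ} (I : Finset (Fin n)) :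
    2 * ((I ×ˢ I).filter fun p ↦ p.1 ≤ p.2).card = I.card ^ 2 + I.card := by
  have h1 : ((I ×ˢ I).filter fun p ↦ p.1 ≤ p.2).card =
      ((I ×ˢ I).filter fun p ↦ p.2 ≤ p.1).card :=
    Finset.card_bij' (fun p _ ↦ p.swap) (fun p _ ↦ p.swap) (by simp +contextual)
      (by simp +contextual) (by simp) (by simp)
  have h2 := Finset.card_union_add_card_inter ((I ×ˢ I).filter fun p ↦ p.1 ≤ p.2)
    ((I ×ˢ I).filter fun p ↦ p.2 ≤ p.1)
  have h3 : ((I ×ˢ I).filter fun p ↦ p.1 ≤ p.2) ∪ ((I ×ˢ I).filter fun p ↦ p.2 ≤ p.1) =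
      I ×ˢ I := by
    ext p; simp only [Finset.mem_union, Finset.mem_filter, Finset.mem_product]
    have := le_total p.1 p.2
    tauto
  have h4 : ((I ×ˢ I).filter fun p ↦ p.1 ≤ p.2) ∩ ((I ×ˢ I).filter fun p ↦ p.2 ≤ p.1) =
      I.diag := by
    ext p
    simp only [Finset.mem_inter, Finset.mem_filter, Finset.mem_product, Finset.mem_diag]
    constructor
    · rintro ⟨⟨⟨h, -⟩, h'⟩, -, h''⟩; exact ⟨h, le_antisymm h' h''⟩
    · rintro ⟨h, e⟩; rw [← e]; simp [h]
  rw [h3, h4, Finset.diag_card, Finset.card_product, ← h1] at h2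
  linarith

-- The root e_b − e_a is the sum of the simple roots a, …, b − 1. Keeping only the condition that
-- both ends lie in I already gives the right leading constant 1/2.
open Classical in
theorem card_supported_rootModelA_le (n : ℕ) (I : Finset (Fin n)) :
    2 * ((Finset.univ.filter fun p : Fin (n + 1) × Fin (n + 1) ↦ p.1 < p.2).filter
      fun p ↦ ∀ k ∉ I, (rootModelA n).coweight k ⬝ᵥ signedRoot p = 0).card ≤
        I.card ^ 2 + I.card := by
  rw [← two_mul_card_prod_filter_le I]
  refine Nat.mul_le_mul_left 2 (Finset.card_le_card_of_surjOn
    (fun q ↦ (q.1.castSucc, q.2.succ)) ?_)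
  intro p hp
  simp only [Finset.coe_filter, Finset.mem_filter, Finset.mem_univ, true_and,
    Set.mem_ofPred_eq] at hp
  obtain ⟨h, hs⟩ := hp
  have key : ∀ k : Fin n, (p.1 : ℕ) ≤ k → (k : ℕ) < p.2 → k ∈ I := by
    intro k h1 h2
    by_contra hk
    have := hs k hk
    rw [dotProduct_signedRoot, if_pos h] at this
    simp [rootModelA, h2, h1.not_gt] at this
  refine ⟨(⟨p.1, by omega⟩, ⟨p.2 - 1, by omega⟩), ?_, ?_⟩
  · simp only [Finset.coe_filter, Finset.mem_product, Set.mem_ofPred_eq, Fin.mk_le_mk]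
    exact ⟨⟨key _ le_rfl h, key _ (by dsimp only; omega) (by dsimp only; omega)⟩, by omega⟩
  · ext
    · rfl
    · simp only [Fin.succ_mk]; omega

theorem finite_typeA {n : ℕ} {W : Type*} [Group W] (cs : CoxeterSystem (CoxeterMatrix.A n) W) :
    Finite W :=
  (rootModelA n).finite cs

theorem tendsto_properProbability_typeA (W : ℕ → Type u) [∀ n, Group (W n)]
    (cs : ∀ n, CoxeterSystem (CoxeterMatrix.A n) (W n)) :
    Tendsto (fun n ↦ (cs n).properProbability) atTop (𝓝 0) := by
  classical
  refine tendsto_properProbability_of_signedRoot (fun n ↦ CoxeterMatrix.A n) 0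
    (fun n _ ↦ rootModelA n) (fun n ↦ Finset.univ.filter fun p ↦ p.1 < p.2) (c := 1 / 2) le_rfl
    (fun n ↦ le_rfl) (fun n _ ↦ rfl) ?_ ?_ ?_ W cs
  · intro n _
    have h := two_mul_card_filter_lt_add (n + 1)
    have h' : (2 * (Finset.univ.filter fun p : Fin (n + 1) × Fin (n + 1) ↦ p.1 < p.2).card +
      (n + 1) : ℝ) = (n + 1) ^ 2 := by exact_mod_cast h
    have : (0 : ℝ) ≤ n := Nat.cast_nonneg n
    linarith
  · intro n _ I
    have h := card_supported_rootModelA_le n I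
    have hI : I.card ≤ n := (Finset.card_le_univ I).trans_eq (Fintype.card_fin n)
    have h' := h.trans (Nat.add_le_add_left hI _)
    have h'' : (2 * ((Finset.univ.filter fun p : Fin (n + 1) × Fin (n + 1) ↦ p.1 < p.2).filter
      fun p ↦ ∀ k ∉ I, (rootModelA n).coweight k ⬝ᵥ signedRoot p = 0).card : ℝ) ≤
        I.card ^ 2 + n := by exact_mod_cast h'
    linarith
  · intro n i j h
    rw [CoxeterMatrix.A_apply] at h
    split_ifs at h <;> omega

end TypeA

/-! ### Type D. -/

section TypeD

theorem coxeterMatrixD_apply (n : ℕ) (i j : Fin n) : coxeterMatrixD n i j =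
    if i = j then 1
    else if ((i : ℕ) = 0 ∧ (j : ℕ) = 2) ∨ ((j : ℕ) = 0 ∧ (i : ℕ) = 2) ∨
        (1 ≤ (i : ℕ) ∧ (i : ℕ) + 1 = j) ∨ (1 ≤ (j : ℕ) ∧ (j : ℕ) + 1 = i) then 3
    else 2 := rfl

/-- The simple roots of type `D n`. -/
def simpleRootD {n : ℕ} (hn : 2 ≤ n) (k : Fin n) : Fin n → ℚ :=
  if (k : ℕ) = 0 then basisVec ⟨0, by omega⟩ + basisVec ⟨1, hn⟩
  else basisVec k - basisVec ⟨k - 1, by omega⟩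

/-- The coweights of type `D n`, up to positive factors. -/
def coweightD {n : ℕ} (k j : Fin n) : ℚ :=
  if k ≤ j then 1 else if (k : ℕ) = 1 then -1 else 0

theorem simpleRootD_of_zero {n : ℕ} (hn : 2 ≤ n) {k : Fin n} (hk : (k : ℕ) = 0) :
    simpleRootD hn k = basisVec ⟨0, by omega⟩ + basisVec ⟨1, hn⟩ := if_pos hk

theorem simpleRootD_of_adjacent {n : ℕ} (hn : 2 ≤ n) {a b : Fin n} (hab : (a : ℕ) + 1 = b) :
    simpleRootD hn b = basisVec b - basisVec a := by
  rw [simpleRootD, if_neg (by omega)]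
  congr
  omega

theorem coweightD_dotProduct_simpleRootD {n : ℕ} (hn : 2 ≤ n) (i j : Fin n) :
    coweightD i ⬝ᵥ simpleRootD hn j = if i = j then (if (i : ℕ) ≤ 1 then 2 else 1) else 0 := by
  rw [simpleRootD]
  split_ifs <;> simp only [dotProduct_sub, dotProduct_add, dotProduct_single, coweightD,
    Fin.le_def, Fin.ext_iff] at * <;> split_ifs <;> first | (exfalso; omega) | norm_num

theorem corootPairing_simpleRootD {n : ℕ} (hn : 2 ≤ n) {i j : Fin n} (hij : i ≠ j) :
    corootPairing (simpleRootD hn i) (simpleRootD hn j) =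
      -(if coxeterMatrixD n i j = 3 then 1 else 0) := by
  rw [coxeterMatrixD_apply, if_neg hij]
  rw [Ne, Fin.ext_iff] at hij
  rw [simpleRootD, simpleRootD]
  split_ifs with h1 h2 h2 <;> first
    | (exfalso; omega)
    | (rw [corootPairing_add (by simp [Fin.ext_iff])]
       simp only [Pi.sub_apply, Pi.single_apply, Fin.ext_iff]
       split_ifs <;> first | (exfalso; omega) | norm_num)
    | (rw [corootPairing_sub (by simp only [Ne, Fin.ext_iff]; omega)]
       simp only [Pi.sub_apply, Pi.add_apply, Pi.single_apply, Fin.ext_iff]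
       split_ifs <;> first | (exfalso; omega) | norm_num)

/-- The reflection in `e 0 + e 1` permutes the other positive roots of type `D`. -/
theorem reflectionEquiv_add_mem_image_signedRoot {n : ℕ} {z o : Fin n} (hz : (z : ℕ) = 0)
    (ho : (o : ℕ) = 1) {p : Fin n × Fin n} (hp : p.1 ≠ p.2)
    (hne : signedRoot p ≠ basisVec z + basisVec o) :
    reflectionEquiv (basisVec z + basisVec o) (signedRoot p) ∈
      (Finset.univ.filter fun p : Fin n × Fin n ↦ p.1 ≠ p.2).image signedRoot := by
  have hzo : z ≠ o := by rintro rfl; omega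
  obtain ⟨a, b⟩ := p
  dsimp only at hp
  have hP : ∀ c d : Fin n, c ≠ d →
      (c, d) ∈ (Finset.univ.filter fun p : Fin n × Fin n ↦ p.1 ≠ p.2) := by simp
  have hadd : ∀ c d : Fin n, c ≠ d → basisVec c + basisVec d ∈
      (Finset.univ.filter fun p : Fin n × Fin n ↦ p.1 ≠ p.2).image signedRoot :=
    fun c d h ↦ add_mem_image_signedRoot h (hP _ _ h) (hP _ _ h.symm)
  have hsub : ∀ c d : Fin n, c < d → -basisVec c + basisVec d ∈
      (Finset.univ.filter fun p : Fin n × Fin n ↦ p.1 ≠ p.2).image signedRoot := by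
    intro c d h
    rw [neg_add_eq_sub]
    exact sub_mem_image_signedRoot h (hP _ _ h.ne)
  rcases lt_or_gt_of_ne hp with h | h
  · rw [signedRoot_of_lt h, map_sub, reflectionEquiv_add_basisVec hzo,
      reflectionEquiv_add_basisVec hzo, if_neg (show ¬b = z by omega), sub_eq_add_neg]
    split_ifs <;> first
      | (exfalso; omega)
      | (rw [neg_neg]; exact hsub _ _ (by omega))
      | (rw [neg_neg]; exact hadd _ _ (by omega))
      | (rw [add_comm]; exact hsub _ _ h)
  · rw [signedRoot_of_gt h] at hne ⊢
    rw [map_add, reflectionEquiv_add_basisVec hzo, reflectionEquiv_add_basisVec hzo,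
      if_neg (show ¬a = z by omega)]
    split_ifs with h1 h2 <;> first
      | (exfalso; omega)
      | exact absurd (by rw [h1, h2, add_comm]) hne
      | exact hsub _ _ (by omega)
      | (rw [add_comm]; exact hsub _ _ (by omega))
      | exact hadd _ _ h.ne'

/-- The root model of type `D n`. -/
def rootModelD {n : ℕ} (hn : 2 ≤ n) : (coxeterMatrixD n).RootModel (Fin n) where
  root := simpleRootD hn
  coweight := coweightD
  pos := (Finset.univ.filter fun p : Fin n × Fin n ↦ p.1 ≠ p.2).image signedRoot
  coweight_root_self i := by
    rw [coweightD_dotProduct_simpleRootD, if_pos rfl]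
    split_ifs <;> norm_num
  coweight_root_of_ne i j hij := by rw [coweightD_dotProduct_simpleRootD, if_neg hij]
  cartan i j hij := by
    refine ⟨_, _, ?_, ?_, corootPairing_simpleRootD hn hij, corootPairing_simpleRootD hn hij.symm,
      ?_⟩
    · split_ifs <;> norm_num
    · split_ifs <;> norm_num
    · rw [(coxeterMatrixD n).symmetric j i]
      have h : coxeterMatrixD n i j = 3 ∨ coxeterMatrixD n i j = 2 := by
        rw [coxeterMatrixD_apply, if_neg hij]
        split_ifs <;> simp
      rcases h with h | h <;> simp [h]
  root_mem_pos i := by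
    rw [simpleRootD]
    split_ifs with h
    · exact add_mem_image_signedRoot (by simp [Fin.ext_iff]) (by simp [Fin.ext_iff])
        (by simp [Fin.ext_iff])
    · have hlt : (⟨i - 1, by omega⟩ : Fin n) < i := by rw [Fin.lt_def]; dsimp only; omega
      exact sub_mem_image_signedRoot hlt (by simpa using hlt.ne)
  coweight_nonneg := by
    simp only [Finset.mem_image, Finset.mem_filter, Finset.mem_univ, true_and]
    rintro _ ⟨p, hp, rfl⟩ k
    rw [dotProduct_signedRoot]
    simp only [coweightD, Fin.le_def, Fin.lt_def, Ne, Fin.ext_iff] at *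
    split_ifs <;> first | (exfalso; omega) | norm_num
  exists_coweight_pos := by
    simp only [Finset.mem_image, Finset.mem_filter, Finset.mem_univ, true_and]
    rintro _ ⟨p, hp, rfl⟩
    by_cases h : p.1 < p.2
    · refine ⟨p.2, ?_⟩
      rw [dotProduct_signedRoot, if_pos h]
      simp only [coweightD, h.not_ge, le_refl, if_true, if_false]
      split_ifs <;> norm_num
    · refine ⟨⟨0, by omega⟩, ?_⟩
      rw [dotProduct_signedRoot, if_neg h, if_pos (by omega)]
      simp [coweightD, Fin.le_def]
  reflection_mem_pos := by
    rintro β hβ i hne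
    obtain ⟨p, hp, rfl⟩ := Finset.mem_image.1 hβ
    rw [Finset.mem_filter] at hp
    replace hp := hp.2
    by_cases hi : (i : ℕ) = 0
    · rw [simpleRootD_of_zero hn hi] at hne ⊢
      exact reflectionEquiv_add_mem_image_signedRoot rfl rfl hp hne
    · have hadj : ((⟨i - 1, by omega⟩ : Fin n) : ℕ) + 1 = i := by dsimp only; omega
      rw [simpleRootD_of_adjacent hn hadj] at hne ⊢
      obtain ⟨p', h, h', e⟩ := exists_reflectionEquiv_signedRoot hadj hne
      exact Finset.mem_image.2
        ⟨p', by simp only [Finset.mem_filter, Finset.mem_univ, true_and]; omega, e.symm⟩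
  pos_subset S hroot hS := by
    simp only [Finset.mem_image, Finset.mem_filter, Finset.mem_univ, true_and]
    rintro _ ⟨⟨a, b⟩, hp, rfl⟩
    have hS' : ∀ a b : Fin n, (a : ℕ) + 1 = b → ∀ x ∈ S,
        reflectionEquiv (basisVec b - basisVec a) x ∈ S := by
      intro a b hab x hx
      rw [← simpleRootD_of_adjacent hn hab]
      exact hS b x hx
    have hroot' : ∀ a b : Fin n, (a : ℕ) + 1 = b → basisVec b - basisVec a ∈ S := by
      intro a b hab
      rw [← simpleRootD_of_adjacent hn hab]
      exact hroot b
    have h01 : (⟨0, by omega⟩ : Fin n) ≠ ⟨1, hn⟩ := by simp [Fin.ext_iff]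
    rcases lt_or_gt_of_ne hp with h | h
    · rw [signedRoot_of_lt h]
      exact sub_mem_of_adjacent_reflections hS' hroot' h
    · rw [signedRoot_of_gt h]
      refine add_mem_of_adjacent_reflections hS' (fun a b ha hab ↦ ?_) h
      have hn0 : 0 < n := by omega
      obtain rfl : a = ⟨0, hn0⟩ := Fin.ext ha
      by_cases hb : (b : ℕ) = 1
      · have hb' : b = ⟨1, hn⟩ := Fin.ext hb
        rw [hb', add_comm, ← simpleRootD_of_zero hn (k := ⟨0, hn0⟩) rfl]
        exact hroot _
      · have hb1 : (⟨1, hn⟩ : Fin n) < b := by simp only [Fin.lt_def] at *; omega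
        -- The reflection in e_0 + e_1 takes e_b − e_1 to e_b + e_0.
        have := hS ⟨0, hn0⟩ _ (sub_mem_of_adjacent_reflections hS' hroot' hb1)
        rwa [simpleRootD_of_zero hn rfl, map_sub, reflectionEquiv_add_basisVec h01,
          reflectionEquiv_add_basisVec h01, if_neg hab.ne', if_neg hb1.ne', if_neg h01.symm,
          if_pos rfl, sub_neg_eq_add] at this

-- If e_b − e_a is supported on I, then a + 1 and b lie in I; if e_a + e_b with b < a is, then a and
-- b do, except that the simple root e_1 + e_0 involves only node 0. The pairs (a + 1, b) lie on or
-- above the diagonal and the pairs (a, b) with b < a below it, so the two kinds do not collide.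
open Classical in
theorem card_supported_rootModelD_le {n : ℕ} (hn : 2 ≤ n) (I : Finset (Fin n)) :
    ((Finset.univ.filter fun p : Fin n × Fin n ↦ p.1 ≠ p.2).filter
      fun p ↦ ∀ k ∉ I, (rootModelD hn).coweight k ⬝ᵥ signedRoot p = 0).card ≤
        I.card ^ 2 + n := by
  have hI : (I ×ˢ I ∪ {(⟨1, hn⟩, ⟨0, by omega⟩)}).card ≤ I.card ^ 2 + n := by
    refine (Finset.card_union_le _ _).trans ?_
    rw [Finset.card_product, Finset.card_singleton, sq]
    omega
  refine le_trans (Finset.card_le_card_of_injOn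
    (fun p ↦ if h : p.1 < p.2 then (⟨p.1 + 1, by omega⟩, p.2) else p) ?_ ?_) hI
  · intro p hp
    simp only [Finset.coe_filter, Finset.mem_filter, Finset.mem_univ, true_and,
      Set.mem_ofPred_eq] at hp
    obtain ⟨hne, hs⟩ := hp
    have key : ∀ k : Fin n, coweightD k ⬝ᵥ signedRoot p ≠ 0 → k ∈ I := by
      intro k h
      by_contra hk
      exact h (hs k hk)
    simp only [dotProduct_signedRoot] at key
    simp only [Finset.coe_union, Finset.coe_product, Set.mem_union, Set.mem_prod, Finset.mem_coe,
      Finset.coe_singleton, Set.mem_singleton_iff]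
    split_ifs with h
    · refine Or.inl ⟨key _ ?_, key _ ?_⟩ <;> rw [if_pos h] <;>
        simp only [coweightD, Fin.le_def, Fin.lt_def] at * <;>
        split_ifs <;> first | (exfalso; omega) | norm_num
    · by_cases h10 : (p.1 : ℕ) = 1 ∧ (p.2 : ℕ) = 0
      · exact Or.inr (Prod.ext (Fin.ext h10.1) (Fin.ext h10.2))
      · have h' : p.2 < p.1 := by omega
        refine Or.inl ⟨key _ ?_, key _ ?_⟩ <;> rw [if_neg h, if_pos h'] <;>
        simp only [coweightD, Fin.le_def, Fin.lt_def] at * <;>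
        split_ifs <;> first | (exfalso; omega) | norm_num
  · intro p hp q hq e
    simp only [Finset.coe_filter, Finset.mem_filter, Finset.mem_univ, true_and,
      Set.mem_ofPred_eq] at hp hq
    have hp' := hp.1
    have hq' := hq.1
    dsimp only at e
    split_ifs at e <;> simp only [Prod.ext_iff, Fin.ext_iff, Fin.lt_def] at * <;> omega

/-- `rootModelD` needs two coordinates; with fewer nodes there are no off-diagonal entries and type
A serves. -/
theorem coxeterMatrixD_eq_A {n : ℕ} (hn : n < 2) : coxeterMatrixD n = CoxeterMatrix.A n := by
  ext i j
  have : i = j := by omega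
  subst this
  change coxeterMatrixD n i i = CoxeterMatrix.A n i i
  simp

theorem finite_typeD {n : ℕ} {W : Type*} [Group W] (cs : CoxeterSystem (coxeterMatrixD n) W) :
    Finite W := by
  rcases le_or_gt 2 n with hn | hn
  · exact (rootModelD hn).finite cs
  · rw [coxeterMatrixD_eq_A hn] at cs
    exact finite_typeA cs

theorem tendsto_properProbability_typeD (W : ℕ → Type u) [∀ n, Group (W n)]
    (cs : ∀ n, CoxeterSystem (coxeterMatrixD n) (W n)) :
    Tendsto (fun n ↦ (cs n).properProbability) atTop (𝓝 0) := by
  classical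
  refine tendsto_properProbability_of_signedRoot (fun n ↦ coxeterMatrixD n) 2
    (fun n hn ↦ rootModelD hn) (fun n ↦ Finset.univ.filter fun p ↦ p.1 ≠ p.2) (c := 1)
    (by norm_num) (fun n ↦ Nat.le_succ n) (fun n _ ↦ rfl) ?_ ?_ ?_ W cs
  · intro n _
    have h : (Finset.univ.filter fun p : Fin n × Fin n ↦ p.1 ≠ p.2).card + n = n ^ 2 := by
      have h1 := (Finset.univ : Finset (Fin n)).offDiag_card
      have h2 : (Finset.univ.filter fun p : Fin n × Fin n ↦ p.1 ≠ p.2) =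
        (Finset.univ : Finset (Fin n)).offDiag := by ext; simp
      rw [h2, h1, Finset.card_univ, Fintype.card_fin, sq, Nat.sub_add_cancel (Nat.le_mul_self n)]
    have h' : ((Finset.univ.filter fun p : Fin n × Fin n ↦ p.1 ≠ p.2).card + n : ℝ) = n ^ 2 := by
      exact_mod_cast h
    linarith
  · intro n hn I
    rw [one_mul]
    exact_mod_cast card_supported_rootModelD_le hn I
  · intro n i j h
    rw [coxeterMatrixD_apply] at h
    split_ifs at h <;> omega

end TypeD

/-! ### Type B. -/

section TypeB

theorem CoxeterMatrix.B_apply (n : ℕ) (i j : Fin n) : CoxeterMatrix.B n i j =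
    if i = j then 1
      else if (i : ℕ) = n - 1 ∧ (j : ℕ) = n - 2 ∨ (j : ℕ) = n - 1 ∧ (i : ℕ) = n - 2 then 4
        else if (j : ℕ) + 1 = i ∨ (i : ℕ) + 1 = j then 3 else 2 := rfl

/-- The simple roots of type `B n`, numbered from the special node on. -/
def simpleRootB {n : ℕ} (k : Fin n) : Fin n → ℚ :=
  if (k : ℕ) = 0 then basisVec k else basisVec k - basisVec ⟨k - 1, by omega⟩

/-- The coweights of type `B n`, numbered from the special node on. -/
def coweightB {n : ℕ} (k j : Fin n) : ℚ := if k ≤ j then 1 else 0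

theorem simpleRootB_of_zero {n : ℕ} {k : Fin n} (hk : (k : ℕ) = 0) :
    simpleRootB k = basisVec k := if_pos hk

theorem simpleRootB_of_adjacent {n : ℕ} {a b : Fin n} (hab : (a : ℕ) + 1 = b) :
    simpleRootB b = basisVec b - basisVec a := by
  rw [simpleRootB, if_neg (by omega)]
  congr
  omega

theorem coweightB_dotProduct_simpleRootB {n : ℕ} (i j : Fin n) :
    coweightB i ⬝ᵥ simpleRootB j = if i = j then 1 else 0 := by
  rw [simpleRootB]
  split_ifs <;> simp only [dotProduct_sub, dotProduct_single, coweightB,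
    Fin.le_def, Fin.ext_iff] at * <;> split_ifs <;> first | (exfalso; omega) | norm_num

theorem corootPairing_simpleRootB {n : ℕ} {i j : Fin n} (hij : i ≠ j) :
    corootPairing (simpleRootB i) (simpleRootB j) =
      -(if (i : ℕ) = 0 ∧ (j : ℕ) = 1 then 2
        else if (i : ℕ) + 1 = j ∨ (j : ℕ) + 1 = i then 1 else 0) := by
  rw [Ne, Fin.ext_iff] at hij
  rw [simpleRootB, simpleRootB]
  split_ifs with h1 h2 h2 <;> first
    | (exfalso; omega)
    | (rw [corootPairing_basisVec]
       simp only [Pi.sub_apply, Pi.single_apply, Fin.ext_iff]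
       split_ifs <;> first | (exfalso; omega) | norm_num)
    | (rw [corootPairing_sub (by simp only [Ne, Fin.ext_iff]; omega)]
       simp only [Pi.sub_apply, Pi.single_apply, Fin.ext_iff]
       split_ifs <;> first | (exfalso; omega) | norm_num)

/-- The root model of type `B n`. -/
def rootModelB (n : ℕ) : (CoxeterMatrix.B n).RootModel (Fin n) where
  -- `CoxeterMatrix.B` puts the label 4 between its last two nodes, whereas `simpleRootB` begins
  -- with the short root; hence the reversal.
  root k := simpleRootB k.rev
  coweight k := coweightB k.rev
  pos := Finset.univ.image signedRoot
  coweight_root_self i := by simp [coweightB_dotProduct_simpleRootB]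
  coweight_root_of_ne i j hij := by simp [coweightB_dotProduct_simpleRootB, hij]
  cartan i j hij := by
    have hij' : i.rev ≠ j.rev := Fin.rev_injective.ne hij
    refine ⟨_, _, ?_, ?_, corootPairing_simpleRootB hij', corootPairing_simpleRootB hij'.symm, ?_⟩
    · split_ifs <;> norm_num
    · split_ifs <;> norm_num
    · rw [CoxeterMatrix.B_apply, if_neg hij]
      rw [Ne, Fin.ext_iff] at hij
      simp only [Fin.val_rev]
      split_ifs <;> first | (exfalso; omega) | norm_num
  root_mem_pos i := by
    rw [simpleRootB]
    split_ifs with h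
    · exact basisVec_mem_image_signedRoot (Finset.mem_univ _)
    · exact sub_mem_image_signedRoot (by rw [Fin.lt_def]; dsimp only; omega) (Finset.mem_univ _)
  coweight_nonneg := by
    simp only [Finset.mem_image, Finset.mem_univ, true_and]
    rintro _ ⟨p, rfl⟩ k
    rw [dotProduct_signedRoot]
    simp only [coweightB, Fin.le_def, Fin.lt_def]
    split_ifs <;> first | (exfalso; omega) | norm_num
  exists_coweight_pos := by
    simp only [Finset.mem_image, Finset.mem_univ, true_and]
    rintro _ ⟨p, rfl⟩
    refine ⟨(max p.1 p.2).rev, ?_⟩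
    rw [dotProduct_signedRoot, Fin.rev_rev]
    simp only [coweightB]
    rcases lt_trichotomy p.1 p.2 with h | h | h
    · simp [h, h.le, h.not_ge]
    · simp [h]
    · simp [h, h.not_gt, h.le, h.not_ge]
  reflection_mem_pos := by
    rintro β hβ i hne
    obtain ⟨p, -, rfl⟩ := Finset.mem_image.1 hβ
    generalize i.rev = i at hne ⊢
    by_cases hi : (i : ℕ) = 0
    · rw [simpleRootB_of_zero hi] at hne ⊢
      obtain ⟨a, b⟩ := p
      rcases lt_trichotomy a b with h | rfl | h
      · rw [signedRoot_of_lt h, map_sub, reflectionEquiv_basisVec, reflectionEquiv_basisVec,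
          if_neg (by rw [Fin.ext_iff]; rw [Fin.lt_def] at h; omega)]
        split_ifs with h1
        · rw [sub_neg_eq_add]
          subst h1
          exact add_mem_image_signedRoot h.ne' (Finset.mem_univ _) (Finset.mem_univ _)
        · exact sub_mem_image_signedRoot h (Finset.mem_univ _)
      · rw [signedRoot_self] at hne ⊢
        rw [reflectionEquiv_basisVec, if_neg (by rintro rfl; exact hne rfl)]
        exact basisVec_mem_image_signedRoot (Finset.mem_univ _)
      · rw [signedRoot_of_gt h, map_add, reflectionEquiv_basisVec, reflectionEquiv_basisVec,
          if_neg (by rw [Fin.ext_iff]; rw [Fin.lt_def] at h; omega)]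
        split_ifs with h1
        · subst h1
          rw [← sub_eq_add_neg]
          exact sub_mem_image_signedRoot h (Finset.mem_univ _)
        · exact add_mem_image_signedRoot h.ne' (Finset.mem_univ _) (Finset.mem_univ _)
    · have hadj : ((⟨i - 1, by omega⟩ : Fin n) : ℕ) + 1 = i := by dsimp only; omega
      rw [simpleRootB_of_adjacent hadj] at hne ⊢
      obtain ⟨p', -, -, e⟩ := exists_reflectionEquiv_signedRoot hadj hne
      exact Finset.mem_image.2 ⟨p', Finset.mem_univ _, e.symm⟩
  pos_subset S hroot hS := by
    rintro β hβ
    obtain ⟨⟨a, b⟩, -, rfl⟩ := Finset.mem_image.1 hβ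
    have hS₀ : ∀ k, ∀ x ∈ S, reflectionEquiv (simpleRootB k) x ∈ S := by
      intro k x hx
      rw [← Fin.rev_rev k]
      exact hS _ x hx
    have hroot₀ : ∀ k, simpleRootB k ∈ S := by
      intro k
      rw [← Fin.rev_rev k]
      exact hroot _
    have hS' : ∀ a b : Fin n, (a : ℕ) + 1 = b → ∀ x ∈ S,
        reflectionEquiv (basisVec b - basisVec a) x ∈ S := by
      intro a b hab x hx
      rw [← simpleRootB_of_adjacent hab]
      exact hS₀ b x hx
    have hroot' : ∀ a b : Fin n, (a : ℕ) + 1 = b → basisVec b - basisVec a ∈ S := by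
      intro a b hab
      rw [← simpleRootB_of_adjacent hab]
      exact hroot₀ b
    rcases lt_trichotomy a b with h | rfl | h
    · rw [signedRoot_of_lt h]
      exact sub_mem_of_adjacent_reflections hS' hroot' h
    · rw [signedRoot_self]
      refine mem_of_adjacent_reflections (f := fun c ↦ basisVec c) (s := ⟨0, a.pos⟩) (t := a) hS'
        ?_ ?_ (Nat.zero_le _) le_rfl
      · intro c d hcd _ _
        rw [reflectionEquiv_sub_basisVec (by rintro rfl; omega), Equiv.swap_apply_left]
      · rw [← simpleRootB_of_zero rfl]
        exact hroot₀ _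
    · rw [signedRoot_of_gt h]
      refine add_mem_of_adjacent_reflections hS' (fun a b ha hab ↦ ?_) h
      -- With a = 0, the reflection in e_0 takes e_b − e_0 to e_b + e_0.
      have := hS₀ a _ (sub_mem_of_adjacent_reflections hS' hroot' hab)
      rwa [simpleRootB_of_zero ha, map_sub, reflectionEquiv_basisVec, reflectionEquiv_basisVec,
        if_neg hab.ne', if_pos rfl, sub_neg_eq_add] at this

-- Differences and sums are encoded as in type D, on both sides of the diagonal of I × I up to
-- reversal; the vectors e_a account for the extra n.
open Classical in
theorem card_supported_rootModelB_le (n : ℕ) (I : Finset (Fin n)) :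
    ((Finset.univ : Finset (Fin n × Fin n)).filter
      fun p ↦ ∀ k ∉ I, (rootModelB n).coweight k ⬝ᵥ signedRoot p = 0).card ≤
        I.card ^ 2 + n := by
  have hJ : (((I.image Fin.rev) ×ˢ (I.image Fin.rev)).disjSum
      (Finset.univ : Finset (Fin n))).card = I.card ^ 2 + n := by
    rw [Finset.card_disjSum, Finset.card_product,
      Finset.card_image_of_injective _ Fin.rev_injective, sq, Finset.card_univ, Fintype.card_fin]
  rw [← hJ]
  refine Finset.card_le_card_of_injOn
    (fun p ↦ if h : p.1 < p.2 then Sum.inl (⟨p.1 + 1, by omega⟩, p.2)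
      else if p.2 < p.1 then Sum.inl p else Sum.inr p.1) ?_ ?_
  · intro p hp
    simp only [Finset.coe_filter, Finset.mem_univ, true_and, Set.mem_ofPred_eq] at hp
    have key : ∀ k : Fin n, coweightB k ⬝ᵥ signedRoot p ≠ 0 → k ∈ I.image Fin.rev := by
      intro k h
      by_contra hk
      refine h ?_
      have := hp k.rev fun hk' ↦ hk (Finset.mem_image.2 ⟨_, hk', Fin.rev_rev k⟩)
      simpa [rootModelB] using this
    simp only [dotProduct_signedRoot] at key
    rw [Finset.mem_coe]
    dsimp only
    split_ifs with h h''
    · rw [Finset.inl_mem_disjSum, Finset.mem_product]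
      refine ⟨key _ ?_, key _ ?_⟩ <;> rw [if_pos h] <;>
        simp only [coweightB, Fin.le_def, Fin.lt_def] at * <;>
        split_ifs <;> first | (exfalso; omega) | norm_num
    · rw [Finset.inl_mem_disjSum, Finset.mem_product]
      refine ⟨key _ ?_, key _ ?_⟩ <;> rw [if_neg h, if_pos h''] <;>
        simp only [coweightB, Fin.le_def, Fin.lt_def] at * <;>
        split_ifs <;> first | (exfalso; omega) | norm_num
    · rw [Finset.inr_mem_disjSum]
      exact Finset.mem_univ _
  · intro p _ q _ e
    dsimp only at e
    split_ifs at e <;>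
      simp only [Sum.inl.injEq, Sum.inr.injEq, Prod.ext_iff, Fin.ext_iff,
        Fin.lt_def] at * <;> omega

theorem finite_typeB {n : ℕ} {W : Type*} [Group W] (cs : CoxeterSystem (CoxeterMatrix.B n) W) :
    Finite W :=
  (rootModelB n).finite cs

theorem tendsto_properProbability_typeB (W : ℕ → Type u) [∀ n, Group (W n)]
    (cs : ∀ n, CoxeterSystem (CoxeterMatrix.B n) (W n)) :
    Tendsto (fun n ↦ (cs n).properProbability) atTop (𝓝 0) := by
  classical
  refine tendsto_properProbability_of_signedRoot (fun n ↦ CoxeterMatrix.B n) 0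
    (fun n _ ↦ rootModelB n) (fun n ↦ Finset.univ) (c := 1)
    (by norm_num) (fun n ↦ Nat.le_succ n) (fun n _ ↦ rfl) ?_ ?_ ?_ W cs
  · intro n _
    simp [sq]
  · intro n _ I
    rw [one_mul]
    exact_mod_cast card_supported_rootModelB_le n I
  · intro n i j h
    rw [CoxeterMatrix.B_apply] at h
    split_ifs at h <;> omega

end TypeB

/-! ### Dihedral groups. -/

section Dihedral

theorem CoxeterMatrix.I_apply (m : ℕ) (i j : Fin 2) :
    CoxeterMatrix.I m i j = if i = j then 1 else m + 2 := rfl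

variable {m : ℕ} {W : Type*} [Group W] (cs : CoxeterSystem (CoxeterMatrix.I m) W)

-- The rotation s_0 s_1 has finite order and is inverted by s_0, so W is the union of the finite
-- cyclic group it generates and one coset.
include cs in
theorem finite_typeI : Finite W := by
  set a := cs.simple 0 * cs.simple 1 with ha
  have hfin : IsOfFinOrder a := by
    refine isOfFinOrder_iff_pow_eq_one.2 ⟨m + 2, by omega, ?_⟩
    have := cs.simple_mul_simple_pow 0 1
    rwa [CoxeterMatrix.I_apply, if_neg (by decide)] at this
  have hZ : (Subgroup.zpowers a : Set W).Finite := finite_zpowers.2 hfin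
  have h0 : ∀ g ∈ Subgroup.zpowers a, cs.simple 0 * g * cs.simple 0 ∈ Subgroup.zpowers a := by
    rintro _ ⟨k, rfl⟩
    have h1 : cs.simple 0 * a * (cs.simple 0)⁻¹ = a⁻¹ := by
      rw [ha, mul_inv_rev, cs.inv_simple, cs.inv_simple, cs.simple_mul_simple_cancel_left]
    have h2 : cs.simple 0 * a ^ k * (cs.simple 0)⁻¹ = (a ^ k)⁻¹ := by
      rw [← conj_zpow, h1, inv_zpow]
    rw [cs.inv_simple] at h2
    simp only [h2]
    exact inv_mem (Subgroup.zpow_mem_zpowers a k)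
  have ha' : a ∈ Subgroup.zpowers a := Subgroup.mem_zpowers a
  have h1 : cs.simple 1 = cs.simple 0 * a := by rw [ha, cs.simple_mul_simple_cancel_left]
  have hall : ∀ w : W, w ∈ Subgroup.zpowers a ∨ w * cs.simple 0 ∈ Subgroup.zpowers a := by
    intro w
    induction w using cs.simple_induction_left with
    | one => exact Or.inl (one_mem _)
    | mul_simple_left w i ih =>
      have h01 : i = 0 ∨ i = 1 := by omega
      rcases h01 with rfl | rfl
      · rcases ih with h | h
        · exact Or.inr (h0 w h)
        · left
          have := h0 _ h
          rwa [← mul_assoc, cs.simple_mul_simple_cancel_right] at this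
      · rw [h1]
        rcases ih with h | h
        · right
          rw [mul_assoc (cs.simple 0)]
          exact h0 _ (mul_mem ha' h)
        · left
          have := h0 _ (mul_mem ha' h)
          rwa [← mul_assoc, ← mul_assoc, cs.simple_mul_simple_cancel_right] at this
  have hfinU : (Set.univ : Set W).Finite := by
    refine (hZ.union (hZ.image (· * cs.simple 0))).subset fun w _ ↦ ?_
    refine (hall w).imp id fun h ↦ ⟨_, h, cs.simple_mul_simple_cancel_right 0⟩
  exact Set.finite_univ_iff.1 hfinU

-- Under the map to the concrete dihedral group, s_0 s_1 goes to a rotation of order m + 2, which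
-- must divide |W|.
include cs in
theorem le_card_typeI : m ≤ Nat.card W := by
  have := finite_typeI cs
  have hl : (CoxeterMatrix.I m).IsLiftable
      (fun i : Fin 2 ↦ (DihedralGroup.sr (if i = 0 then 0 else 1) : DihedralGroup (m + 2))) := by
    intro i j
    rw [CoxeterMatrix.I_apply]
    split_ifs with h
    · subst h; simp
    · rw [DihedralGroup.sr_mul_sr, DihedralGroup.r_pow, DihedralGroup.one_def]
      congr 1
      have : ((m + 2 : ℕ) : ZMod (m + 2)) = 0 := ZMod.natCast_self _
      rw [this, mul_zero]
  set φ := cs.lift ⟨_, hl⟩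
  have hφ : φ (cs.simple 0 * cs.simple 1) = DihedralGroup.r 1 := by
    rw [map_mul, cs.lift_apply_simple hl, cs.lift_apply_simple hl]
    simp
  have h1 : orderOf (DihedralGroup.r 1 : DihedralGroup (m + 2)) = m + 2 :=
    DihedralGroup.orderOf_r_one
  have h2 := orderOf_map_dvd φ (cs.simple 0 * cs.simple 1)
  rw [hφ, h1] at h2
  have h3 := Nat.le_of_dvd Nat.card_pos (h2.trans (orderOf_dvd_natCard _))
  omega

theorem maxw0_one_le_typeI : cs.maxw0 1 ≤ 1 := by
  refine Finset.sup_le fun I hI ↦ ?_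
  obtain ⟨i, rfl⟩ := Finset.card_eq_one.1 (Finset.mem_powersetCard.1 hI).2
  refine csSup_le ⟨_, 1, one_mem _, rfl⟩ ?_
  rintro _ ⟨w, hw, rfl⟩
  rw [SetLike.mem_coe, CoxeterSystem.parabolic, Finset.coe_singleton, Set.image_singleton,
    ← Subgroup.zpowers_eq_closure] at hw
  obtain ⟨k, rfl⟩ := hw
  rcases Int.even_or_odd' k with ⟨j, rfl | rfl⟩
  · simp [zpow_mul]
  · simp [zpow_add, zpow_mul]

/-- Left multiplication by s_i exchanges the elements with and without the descent i. -/
theorem card_isLeftDescent_typeI (i : Fin 2) :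
    2 * Nat.card {w : W // cs.IsLeftDescent w i} = Nat.card W := by
  classical
  have := finite_typeI cs
  have := Fintype.ofFinite W
  have h : Nat.card {w : W // cs.IsLeftDescent w i} = Nat.card {w : W // ¬cs.IsLeftDescent w i} :=
    Nat.card_congr ((Equiv.mulLeft (cs.simple i)).subtypeEquiv fun w ↦
      cs.isLeftDescent_iff_not_isLeftDescent_mul)
  have h' := Fintype.card_subtype_compl (fun w : W ↦ cs.IsLeftDescent w i)
  have h'' := Fintype.card_subtype_le (fun w : W ↦ cs.IsLeftDescent w i)
  simp only [Nat.card_eq_fintype_card] at h ⊢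
  omega

/-- At most one element of a dihedral group has two left descents. -/
theorem card_two_descents_typeI_le :
    Nat.card {w : W // cs.IsLeftDescent w 0 ∧ cs.IsLeftDescent w 1} ≤ 1 := by
  classical
  have := finite_typeI cs
  have := Fintype.ofFinite W
  have h0 := card_isLeftDescent_typeI cs 0
  have h1 := card_isLeftDescent_typeI cs 1
  simp only [Nat.card_eq_fintype_card, Fintype.card_subtype] at h0 h1 ⊢
  have h2 := Finset.card_union_add_card_inter (Finset.univ.filter fun w : W ↦ cs.IsLeftDescent w 0)
    (Finset.univ.filter fun w : W ↦ cs.IsLeftDescent w 1)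
  rw [← Finset.filter_and] at h2
  -- Two halves of W whose union misses only the identity overlap in at most one element.
  have h3 : Fintype.card W ≤ ((Finset.univ.filter fun w : W ↦ cs.IsLeftDescent w 0) ∪
      (Finset.univ.filter fun w : W ↦ cs.IsLeftDescent w 1)).card + 1 := by
    have : (Finset.univ : Finset W) ⊆ insert 1 ((Finset.univ.filter fun w : W ↦
        cs.IsLeftDescent w 0) ∪ (Finset.univ.filter fun w : W ↦ cs.IsLeftDescent w 1)) := by
      intro w _
      rw [Finset.mem_insert, Finset.mem_union, Finset.mem_filter, Finset.mem_filter]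
      by_cases hw : w = 1
      · exact Or.inl hw
      · obtain ⟨i, hi⟩ := cs.exists_leftDescent_of_ne_one hw
        have h01 : i = 0 ∨ i = 1 := by omega
        rcases h01 with rfl | rfl <;> simp [hi]
    exact (Finset.card_le_card this).trans (Finset.card_insert_le _ _)
  omega

/-- The number of words of length at most `3` in two letters. -/
noncomputable def numShortWords : ℕ := {l : List (Fin 2) | l.length ≤ 3}.ncard

/-- Except for the element with two descents, a proper element is 1 or has a single descent, and
then ℓ(w) ≤ 2 + 1; so it is given by a word of length at most 3, independently of m. -/
theorem card_isProper_typeI_le : Nat.card {w : W // cs.IsProper w} ≤ numShortWords + 1 := by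
  have := finite_typeI cs
  have hsub : {w : W | cs.IsProper w} ⊆ cs.wordProd '' {l : List (Fin 2) | l.length ≤ 3} ∪
      {w : W | cs.IsLeftDescent w 0 ∧ cs.IsLeftDescent w 1} := by
    intro w hw
    by_cases h : cs.IsLeftDescent w 0 ∧ cs.IsLeftDescent w 1
    · exact Or.inr h
    left
    obtain ⟨l, hl, rfl⟩ := cs.exists_isReduced w
    refine ⟨l, ?_, rfl⟩
    change l.length ≤ 3
    rw [← hl.eq]
    rcases eq_or_ne (cs.wordProd l) 1 with h1 | h1
    · simp [h1]
    obtain ⟨i, hi⟩ := cs.exists_leftDescent_of_ne_one h1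
    have hset : {j | cs.IsLeftDescent (cs.wordProd l) j} = {i} := by
      ext j
      simp only [Set.mem_ofPred_eq, Set.mem_singleton_iff]
      refine ⟨fun hj ↦ ?_, fun e ↦ e ▸ hi⟩
      by_contra hne
      have hcases : (i = 0 ∧ j = 1) ∨ (i = 1 ∧ j = 0) := by omega
      rcases hcases with ⟨rfl, rfl⟩ | ⟨rfl, rfl⟩
      · exact h ⟨hi, hj⟩
      · exact h ⟨hj, hi⟩
    have hw' : cs.length (cs.wordProd l) ≤
        Fintype.card (Fin 2) + cs.maxw0 (cs.numLeftDescents (cs.wordProd l)) := hw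
    rw [CoxeterSystem.numLeftDescents, hset, Set.ncard_singleton, Fintype.card_fin] at hw'
    have := maxw0_one_le_typeI cs
    omega
  have hfin : {l : List (Fin 2) | l.length ≤ 3}.Finite := List.finite_length_le _ _
  have h1 := card_two_descents_typeI_le cs
  calc Nat.card {w : W // cs.IsProper w} = {w : W | cs.IsProper w}.ncard := rfl
    _ ≤ _ := Set.ncard_le_ncard hsub (Set.toFinite _)
    _ ≤ _ := Set.ncard_union_le _ _
    _ ≤ _ := Nat.add_le_add (Set.ncard_image_le hfin) h1

end Dihedral

theorem tendsto_properProbability_typeI (W : ℕ → Type u) [∀ n, Group (W n)]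
    (cs : ∀ n, CoxeterSystem (CoxeterMatrix.I n) (W n)) :
    Tendsto (fun n ↦ (cs n).properProbability) atTop (𝓝 0) := by
  refine tendsto_zero_of_le_const_div (numShortWords + 1) 1
    (fun n ↦ (cs n).properProbability_nonneg) fun n hn ↦ ?_
  have h1 : (Nat.card {w : W n // (cs n).IsProper w} : ℝ) ≤ numShortWords + 1 := by
    exact_mod_cast card_isProper_typeI_le (cs n)
  have h2 : (n : ℝ) ≤ Nat.card (W n) := by exact_mod_cast le_card_typeI (cs n)
  have h3 : (0 : ℝ) < n := by exact_mod_cast hn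
  rw [CoxeterSystem.properProbability]
  gcongr

/-- In each of the four infinite families the groups are finite and the probability that a uniformly
random element is proper tends to `0`. The matrix `CoxeterMatrix.I n` has off-diagonal entry `n + 2`,
so it is the Coxeter matrix of type `I₂(n + 2)`. -/
theorem theorem1p2 :
    (∀ (W : ℕ → Type u) [∀ n, Group (W n)]
        (cs : ∀ n, CoxeterSystem (CoxeterMatrix.A n) (W n)),
      (∀ n, Finite (W n)) ∧
        Tendsto (fun n ↦ (cs n).properProbability) atTop (𝓝 0)) ∧
    (∀ (W : ℕ → Type u) [∀ n, Group (W n)]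
        (cs : ∀ n, CoxeterSystem (CoxeterMatrix.B n) (W n)),
      (∀ n, Finite (W n)) ∧
        Tendsto (fun n ↦ (cs n).properProbability) atTop (𝓝 0)) ∧
    (∀ (W : ℕ → Type u) [∀ n, Group (W n)]
        (cs : ∀ n, CoxeterSystem (coxeterMatrixD n) (W n)),
      (∀ n, Finite (W n)) ∧
        Tendsto (fun n ↦ (cs n).properProbability) atTop (𝓝 0)) ∧
    (∀ (W : ℕ → Type u) [∀ n, Group (W n)]
        (cs : ∀ n, CoxeterSystem (CoxeterMatrix.I n) (W n)),
      (∀ n, Finite (W n)) ∧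
        Tendsto (fun n ↦ (cs n).properProbability) atTop (𝓝 0)) := by
  exact ⟨fun W _ cs ↦ ⟨fun n ↦ finite_typeA (cs n), tendsto_properProbability_typeA W cs⟩,
    fun W _ cs ↦ ⟨fun n ↦ finite_typeB (cs n), tendsto_properProbability_typeB W cs⟩,
    fun W _ cs ↦ ⟨fun n ↦ finite_typeD (cs n), tendsto_properProbability_typeD W cs⟩,
    fun W _ cs ↦ ⟨fun n ↦ finite_typeI (cs n), tendsto_properProbability_typeI W cs⟩⟩
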